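/- **Setting.** Let $G=(V,E)$ be a directed graph with $m=|E|$ edges, each edge $e$ having an integer capacity $c_e>0$; put $c=\max_e c_e$, and assume $mc\ge 2$. Requests $r_0,r_1,\dots$ arrive one at a time; $r_i$ is a simple path (with at least one edge) together with a cost $p_i>0$. An online algorithm must keep, at all times, the number of accepted requests through each edge $e$ at most $c_e$; it may preempt (reject later) an accepted request, but cannot accept a request after rejecting it. $C_{OPT}$ is the minimum, over all feasible solutions for the whole sequence, of the total cost of the rejected requests. A randomized algorithm is $\beta$-competitive if on every finite request sequence the expected total cost of its rejected requests is at most $\beta\,C_{OPT}$. Here $\log$ is the natural logarithm and $REQ_e$ is the set of requests that have arrived so far and contain $e$. **Fractional algorithm with guess $\alpha>0$.** A request is *small* if $p_i\le\alpha/(mc)$, *big* if $p_i>2\alpha$, and *medium* otherwise. Let $g=2mc$ and $\hat p_i=p_i\,mc/\alpha$. Every medium request has a weight $f_i$, initially $0$. Let $ALIVE_e$ be the set of medium $i\in REQ_e$ with $f_i<1$, and let $n_e=|ALIVE_e|-(c_e-b_e)$, where $b_e$ is the number of big requests in $REQ_e$. When a request arrives, the following is done for the edges $e$ of its path, one after the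 other in the order of the path: while $\sum_{i\in ALIVE_e}f_i<n_e$, set $f_i=1/(gc)$ for each $i\in ALIVE_e$ with $f_i=0$, then replace $f_i$ by $f_i\bigl(1+\frac1{n_e\hat p_i}\bigr)$ for each $i\in ALIVE_e$, and update $ALIVE_e$, $n_e$. The cost of the fractional solution is $\sum_{i\text{ medium}}\min\{f_i,1\}\,p_i$. (If some $b_e>c_e$, the guess is rejected anyway, as described next, and the weights do not matter.) **Guessing $\alpha$.** Let $D>0$ be a parameter. There is no guess, and all weights are $0$, until for the first time $|REQ_e|>c_e$ for some edge $e$; the first guess is then the minimum cost of the requests that contain such an edge. After each arrival, the guess $\alpha$ is doubled as long as, for the requests that have arrived so far, $b_e>c_e$ for some $e$ or the fractional solution with guess $\alpha$ costs more than $D\,\alpha\log(mc)$. When the guess changes, the old weights are forgotten and the fractional algorithm with the new guess is rerun from zero weights on all requests that have arrived so far. **Randomized algorithm.** When request $r_t$ arrives: 1. Update the guess $\alpha$ and the weights as above. Reject all small requests. 2. Reject all requests of weight at least $\frac1{12\log(mc)}$. 3. Reject, with fresh independent coins, every request $r_i$ ($i\le t$) with probability $12\,\delta_i\log(mc)$,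 where $\delta_i$ is the increase of its weight in this round (its whole new weight, if the guess has changed). 4. If accepting $r_t$ (when it has not been rejected yet) exceeds no capacity, accept it. Otherwise, if $r_t$ is not big, reject it; if $r_t$ is big, accept it and preempt all medium requests through the edges that are over capacity. Rejected requests stay rejected. While there is no guess, no request is small and nothing is rejected. **Theorem.** There is an absolute constant $D_0>0$ such that for every $D\ge D_0$ there is a constant $K>0$, depending only on $D$, with the following property. For every network with $mc\ge2$, the randomized algorithm above is a preemptive online algorithm whose accepted requests respect all capacities at all times and for all outcomes of the coins, and it is $K\log^2(mc)$-competitive. In particular, the weighted admission control problem has an $O(\log^2(mc))$-competitive randomized preemptive algorithm. -/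

import Mathlib

open MeasureTheory

noncomputable section

namespace AdmissionControl

/-! ## The admission control problem -/

/-- A directed graph (parallel edges are allowed) with edge set `E`, whose edges carry positive
integer capacities. -/
structure Network (V E : Type*) where
  src : E → V
  tgt : E → V
  cap : E → ℕ
  cap_pos : ∀ e, 0 < cap e

variable {V E : Type*} [Fintype E] [DecidableEq E]

/-- The number `m` of edges. -/
def Network.m (_N : Network V E) : ℕ := Fintype.card E

/-- The maximum edge capacity `c`. -/
def Network.c (N : Network V E) : ℕ := Finset.univ.sup N.cap

/-- The product `m c` as a real number. -/
def Network.mc (N : Network V E) : ℝ := (N.m : ℝ) * (N.c : ℝ)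

/-- The vertices visited by a list of consecutive edges, in order. -/
def Network.vertices (N : Network V E) : List E → List V
  | [] => []
  | e :: l => N.src e :: (e :: l).map N.tgt

/-- A (directed) simple path with at least one edge, given by its list of edges: consecutive edges
fit together and no vertex is visited twice. -/
structure Network.IsSimplePath (N : Network V E) (p : List E) : Prop where
  ne_nil : p ≠ []
  chain : p.IsChain (fun a b => N.tgt a = N.src b)
  nodup : (N.vertices p).Nodup

/-- A request: a simple path together with a positive cost. -/
structure Request (N : Network V E) where
  path : List E
  isSimplePath : N.IsSimplePath path
  cost : ℝ
  cost_pos : 0 < cost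

variable {N : Network V E}

/-! In what follows `σ : ℕ → Request N` is the request sequence, the requests are named by their
indices, and "time `t`" is the moment when exactly the requests `0, …, t - 1` have arrived. -/

/-- `REQ_e` at time `t`: the requests that have arrived so far and whose paths contain `e`. -/
def REQ (σ : ℕ → Request N) (t : ℕ) (e : E) : Finset ℕ :=
  (Finset.range t).filter fun i => e ∈ (σ i).path

/-- The set `A` of accepted requests respects all capacities (at time `t`). -/
def Feasible (σ : ℕ → Request N) (t : ℕ) (A : Finset ℕ) : Prop :=
  ∀ e, (REQ σ t e ∩ A).card ≤ N.cap e

/-- The total cost of the set `R` of rejected requests. -/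
def rejectionCost (σ : ℕ → Request N) (R : Finset ℕ) : ℝ := ∑ i ∈ R, (σ i).cost

/-- `C_OPT` at time `t`: the minimum cost of the rejected requests over all feasible solutions (a
minimum over a finite non-empty set). -/
def optCost (σ : ℕ → Request N) (t : ℕ) : ℝ :=
  sInf {x | ∃ A ⊆ Finset.range t, Feasible σ t A ∧ x = rejectionCost σ (Finset.range t \ A)}

/-- `alg σ ω t` is the set of requests that are rejected at time `t` by a randomized algorithm,
where `ω` stands for its random bits. The algorithm is online (at time `t` it knows only the first
`t` requests), it may preempt an accepted request but never accepts a request that it has rejected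
before, and for every outcome of the random bits the set of accepted requests respects the
capacities at all times. -/
structure IsPreemptiveOnline {Ω : Type*} (alg : (ℕ → Request N) → Ω → ℕ → Finset ℕ) : Prop where
  online : ∀ σ σ' ω t, (∀ i < t, σ i = σ' i) → alg σ ω t = alg σ' ω t
  subset_arrived : ∀ σ ω t, alg σ ω t ⊆ Finset.range t
  irrevocable : ∀ σ ω t, alg σ ω t ⊆ alg σ ω (t + 1)
  feasible : ∀ σ ω t, Feasible σ t (Finset.range t \ alg σ ω t)

/-- The randomized algorithm `alg` is `β`-competitive: for every finite request sequence (the first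
`t` terms of `σ`) the expected cost of the rejected requests is at most `β C_OPT`. -/
def IsCompetitive {Ω : Type*} [MeasurableSpace Ω] (P : Measure Ω) (β : ℝ)
    (alg : (ℕ → Request N) → Ω → ℕ → Finset ℕ) : Prop :=
  ∀ σ t, Integrable (fun ω => rejectionCost σ (alg σ ω t)) P ∧
    ∫ ω, rejectionCost σ (alg σ ω t) ∂P ≤ β * optCost σ t

/-! ## The fractional algorithm for a given guess `α` of the optimum

Requests of cost at most `α / (m c)` are completely rejected, requests of cost more than `2 α` are
completely accepted (they use up capacity), and the weights `f i` concern the remaining ones. -/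

/-- The requests in `R_small`. -/
def IsSmall (α : ℝ) (r : Request N) : Prop := r.cost ≤ α / N.mc

/-- The requests in `R_big`. -/
def IsBig (α : ℝ) (r : Request N) : Prop := 2 * α < r.cost

/-- The requests that the fractional algorithm handles by weights. -/
def IsMedium (α : ℝ) (r : Request N) : Prop := ¬ IsSmall α r ∧ ¬ IsBig α r

/-- The normalized cost: for a medium request it lies between `1` and `g = 2 m c`. -/
def normCost (α : ℝ) (r : Request N) : ℝ := r.cost * N.mc / α

open Classical in
/-- `ALIVE_e`: the medium requests of `REQ_e` that have not been fully rejected. -/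
def ALIVE (α : ℝ) (σ : ℕ → Request N) (t : ℕ) (f : ℕ → ℝ) (e : E) : Finset ℕ :=
  (REQ σ t e).filter fun i => IsMedium α (σ i) ∧ f i < 1

open Classical in
/-- The big requests of `REQ_e`. -/
def BIG (α : ℝ) (σ : ℕ → Request N) (t : ℕ) (e : E) : Finset ℕ :=
  (REQ σ t e).filter fun i => IsBig α (σ i)

/-- `n_e = |ALIVE_e| - c_e`, where the capacity `c_e` is decreased by the number of big requests
through `e`, because these are accepted. -/
def excess (α : ℝ) (σ : ℕ → Request N) (t : ℕ) (f : ℕ → ℝ) (e : E) : ℝ :=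
  ((ALIVE α σ t f e).card : ℝ) - ((N.cap e : ℝ) - ((BIG α σ t e).card : ℝ))

/-- The requirement from a fractional solution at the edge `e`. -/
def Satisfied (α : ℝ) (σ : ℕ → Request N) (t : ℕ) (e : E) (f : ℕ → ℝ) : Prop :=
  excess α σ t f e ≤ ∑ i ∈ ALIVE α σ t f e, f i

/-- One weight augmentation for the edge `e`: every alive request of weight `0` gets the weight
`1 / (g c)` with `g = 2 m c`, then the weight of every alive request is multiplied by
`1 + 1 / (n_e p_i)`. -/
def augment (α : ℝ) (σ : ℕ → Request N) (t : ℕ) (e : E) (f : ℕ → ℝ) : ℕ → ℝ := fun i =>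
  if i ∈ ALIVE α σ t f e then
    (if f i = 0 then 1 / (2 * N.mc * N.c) else f i) *
      (1 + 1 / (excess α σ t f e * normCost α (σ i)))
  else f i

/-- Perform weight augmentations for the edge `e` as long as its requirement is violated. -/
def processEdge (α : ℝ) (σ : ℕ → Request N) (t : ℕ) (f : ℕ → ℝ) (e : E) : ℕ → ℝ :=
  (augment α σ t e)^[sInf {k | Satisfied α σ t e ((augment α σ t e)^[k] f)}] f

/-- The weights of the fractional algorithm with guess `α` at time `t`. When a request arrives, the
edges of its path are processed one after the other. -/
def fracWeight (α : ℝ) (σ : ℕ → Request N) : ℕ → ℕ → ℝ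
  | 0 => fun _ => 0
  | t + 1 => (σ t).path.foldl (processEdge α σ (t + 1)) (fracWeight α σ t)

open Classical in
/-- The cost of the fractional solution at time `t`. -/
def fracCost (α : ℝ) (σ : ℕ → Request N) (t : ℕ) : ℝ :=
  ∑ i ∈ (Finset.range t).filter (fun i => IsMedium α (σ i)),
    min (fracWeight α σ t i) 1 * (σ i).cost

/-! ## Guessing the optimum by doubling -/

/-- The guess `α` is found to be too small at time `t`: the requests of cost more than `2 α` alone
exceed some capacity, or the cost of the fractional solution exceeds `D α log (m c)`. -/
def Refuted (D α : ℝ) (σ : ℕ → Request N) (t : ℕ) : Prop :=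
  (∃ e, N.cap e < (BIG α σ t e).card) ∨ D * α * Real.log N.mc < fracCost α σ t

/-- The edge `e` is requested more often than its capacity allows. -/
def Overloaded (σ : ℕ → Request N) (t : ℕ) (e : E) : Prop := N.cap e < (REQ σ t e).card

open Classical in
/-- The first guess: the minimum cost of a request through an overloaded edge. As long as no edge
is overloaded, there is no guess yet, which is encoded by the value `0`. -/
def initialGuess (σ : ℕ → Request N) (t : ℕ) : ℝ :=
  if ∃ e, Overloaded σ t e then
    sInf {x | ∃ e, Overloaded σ t e ∧ ∃ i ∈ REQ σ t e, x = (σ i).cost}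
  else 0

/-- The guess after the previous guess was `a`: it is doubled until it is no longer refuted. -/
def doubleUntil (D a : ℝ) (σ : ℕ → Request N) (t : ℕ) : ℝ :=
  a * 2 ^ sInf {k : ℕ | ¬ Refuted D (a * 2 ^ k) σ t}

/-- The guess of the optimum that is in use at time `t` (`0` if there is none). -/
def guess (D : ℝ) (σ : ℕ → Request N) : ℕ → ℝ
  | 0 => 0
  | t + 1 => doubleUntil D
      (if guess D σ t = 0 then initialGuess σ (t + 1) else guess D σ t) σ (t + 1)

/-- The weights `f i` that the randomized algorithm maintains: those of the fractional algorithm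
with the current guess; all of them are `0` as long as there is no guess. -/
def weight (D : ℝ) (σ : ℕ → Request N) (t : ℕ) : ℕ → ℝ :=
  if guess D σ t = 0 then fun _ => 0 else fracWeight (guess D σ t) σ t

/-- The increase of the weight of request `i` upon the arrival of request `t`. If the guess has
changed, then the old fractions are forgotten and the weights grow anew from `0`. -/
def increase (D : ℝ) (σ : ℕ → Request N) (t i : ℕ) : ℝ :=
  if guess D σ (t + 1) = guess D σ t then weight D σ (t + 1) i - weight D σ t i
  else weight D σ (t + 1) i

/-! ## The randomized algorithm -/

/-- The random bits: one number in `[0, 1]` for each pair of a time step and a request. -/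
abbrev Coins : Type := ℕ × ℕ → unitInterval

/-- The coins are independent and uniformly distributed on `[0, 1]`. -/
def coinMeasure : Measure Coins := Measure.infinitePi fun _ => (volume : Measure unitInterval)

open Classical in
/-- The requests that are rejected upon the arrival of request `t` before the capacities are
checked: those that are small for the current guess, those of weight at least `1 / (12 log (m c))`,
and, independently, each request with probability `12 δ log (m c)`, where `δ` is the increase of
its weight. -/
def roundingRejections (D : ℝ) (σ : ℕ → Request N) (ω : Coins) (t : ℕ) : Finset ℕ :=
  (Finset.range (t + 1)).filter fun i =>
    IsSmall (guess D σ (t + 1)) (σ i) ∨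
    1 / (12 * Real.log N.mc) ≤ weight D σ (t + 1) i ∨
    (ω (t, i) : ℝ) < 12 * increase D σ t i * Real.log N.mc

/-- The edges that would be over capacity if exactly the requests in `R` were rejected. -/
def overCapacity (σ : ℕ → Request N) (t : ℕ) (R : Finset ℕ) : Finset E :=
  Finset.univ.filter fun e => N.cap e < (REQ σ t e \ R).card

open Classical in
/-- The final capacity check upon the arrival of request `t`, where `R` is the set of requests that
are already rejected. If request `t` can be accepted, nothing else is rejected. Otherwise request
`t` is rejected, unless it is big for the current guess `α`: then it is accepted, and the medium
requests through the edges that it makes over capacity are preempted. -/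
def capacityCheck (α : ℝ) (σ : ℕ → Request N) (t : ℕ) (R : Finset ℕ) : Finset ℕ :=
  if overCapacity σ (t + 1) R = ∅ then R
  else if IsBig α (σ t) then
    R ∪ (Finset.range (t + 1)).filter fun i =>
      IsMedium α (σ i) ∧ ∃ e ∈ overCapacity σ (t + 1) R, e ∈ (σ i).path
  else insert t R

/-- The randomized algorithm, with parameter `D` of the doubling: the set of requests that are
rejected at time `t`. -/
def randomizedAlgorithm (N : Network V E) (D : ℝ) (σ : ℕ → Request N) (ω : Coins) :
    ℕ → Finset ℕ
  | 0 => ∅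
  | t + 1 => capacityCheck (guess D σ (t + 1)) σ t
      (randomizedAlgorithm N D σ ω t ∪ roundingRejections D σ ω t)

end AdmissionControl

end

namespace AdmissionControl

set_option linter.unusedSectionVars false

variable {V E : Type*} [Fintype E] [DecidableEq E] {N : Network V E}

/-! ### Networks -/

/-! The fractional algorithm is analysed by a potential. Let `R` be a set of requests whose
rejection leaves room for all big requests (`Covers`), for instance the requests rejected by an
optimal solution of cost at most `α`. A violated edge has at least `n_e` alive requests in `R`, and
an augmentation raises the cost-scaled log-weight of each by at least `log 2 / n_e`. So every
augmentation raises the potential of `R` by at least `log 2` (`potential_augment`), while it raises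
the normalized fractional cost by at most 4 (`normFracCost_augment`). Weights stay between `1 / (g
c)` and 2, so the potential is `O(mc log mc)` if `R` costs at most `α`; hence the fractional cost is
at most `24 α log mc` (`fracCost_le`). For `D ≥ 24` no guess `α ≥ C_OPT` is refuted, and the guess
never exceeds `2 C_OPT` (`guess_le_two_mul_optCost`).

For the rounding, a request of weight `w` survives all its coins with probability at most `exp (-12
w log mc)`. The fractional requirement at an edge and a Chernoff bound show that the edge is over
capacity before the check of a given round with probability at most `1 / (mc)^3`
(`coinMeasure_real_mem_overCapacity_le`). A failing check costs at most `2α`, or `2α mc` if the new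
request is big. Under an unrefuted guess there are few medium and big requests, so all checks
together cost `O(α log mc)` in expectation (`sum_checkCost_le`).

What remains are small requests, which cost at most `C_OPT + α`, and requests rejected by coins or
for their weight; these cost `O(log mc)` times the fractional increases, that is, `O(α log² mc)`.
Since guesses at least double when they change, the costs of all phases form a geometric sum
dominated by the last guess (`sum_le_of_doubling`). -/

lemma Network.two_le_mc (hN : 2 ≤ N.m * N.c) : 2 ≤ N.mc := by
  unfold Network.mc; exact_mod_cast hN

lemma Network.one_le_m (hN : 2 ≤ N.m * N.c) : (1 : ℝ) ≤ N.m := by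
  have : 0 < N.m := Nat.pos_of_ne_zero fun h => by simp [h] at hN
  exact_mod_cast this

lemma Network.one_le_c (hN : 2 ≤ N.m * N.c) : (1 : ℝ) ≤ N.c := by
  have : 0 < N.c := Nat.pos_of_ne_zero fun h => by simp [h] at hN
  exact_mod_cast this

lemma Network.cap_le_c (N : Network V E) (e : E) : N.cap e ≤ N.c :=
  Finset.le_sup (f := N.cap) (Finset.mem_univ e)

lemma Network.c_le_mc (hN : 2 ≤ N.m * N.c) : (N.c : ℝ) ≤ N.mc := by
  have := N.one_le_m hN; have := N.one_le_c hN
  unfold Network.mc; nlinarith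

lemma Network.m_le_mc (hN : 2 ≤ N.m * N.c) : (N.m : ℝ) ≤ N.mc := by
  have := N.one_le_m hN; have := N.one_le_c hN
  unfold Network.mc; nlinarith

lemma Network.sum_cap_le (N : Network V E) : (∑ e, N.cap e : ℝ) ≤ N.mc := by
  calc (∑ e, N.cap e : ℝ) ≤ ∑ _e : E, (N.c : ℝ) :=
        Finset.sum_le_sum fun e _ => by exact_mod_cast N.cap_le_c e
    _ = N.mc := by simp [Network.mc, Network.m]

lemma Network.log_two_le (hN : 2 ≤ N.m * N.c) : Real.log 2 ≤ Real.log N.mc :=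
  Real.log_le_log (by norm_num) (N.two_le_mc hN)

lemma Network.log_pos (hN : 2 ≤ N.m * N.c) : 0 < Real.log N.mc :=
  Real.log_pos (by linarith [N.two_le_mc hN])

/-- The weight `1 / (g c)` that a request gets when it is first augmented. -/
noncomputable def Network.startWeight (N : Network V E) : ℝ := 1 / (2 * N.mc * N.c)

lemma Network.startWeight_pos (hN : 2 ≤ N.m * N.c) : 0 < N.startWeight := by
  have := N.two_le_mc hN; have := N.one_le_c hN
  unfold Network.startWeight; positivity

lemma Network.startWeight_le_one (hN : 2 ≤ N.m * N.c) : N.startWeight ≤ 1 := by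
  have := N.two_le_mc hN; have := N.one_le_c hN
  unfold Network.startWeight
  rw [div_le_one (by positivity)]; nlinarith

/-! ### Requests through an edge -/

variable {α D a : ℝ} {σ σ' : ℕ → Request N} {s t : ℕ} {e : E} {f f' : ℕ → ℝ} {R : Finset ℕ}

@[simp] lemma mem_REQ {i : ℕ} : i ∈ REQ σ t e ↔ i < t ∧ e ∈ (σ i).path := by
  simp [REQ]

@[simp] lemma mem_ALIVE {i : ℕ} :
    i ∈ ALIVE α σ t f e ↔ (i < t ∧ e ∈ (σ i).path) ∧ IsMedium α (σ i) ∧ f i < 1 := by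
  simp [ALIVE]

@[simp] lemma mem_BIG {i : ℕ} :
    i ∈ BIG α σ t e ↔ (i < t ∧ e ∈ (σ i).path) ∧ IsBig α (σ i) := by
  simp [BIG]

lemma REQ_mono (h : s ≤ t) : REQ σ s e ⊆ REQ σ t e := fun i hi => by
  simp only [mem_REQ] at *; exact ⟨hi.1.trans_le h, hi.2⟩

lemma BIG_mono (h : s ≤ t) : BIG α σ s e ⊆ BIG α σ t e := fun i hi => by
  simp only [mem_BIG] at *; exact ⟨⟨hi.1.1.trans_le h, hi.1.2⟩, hi.2⟩

lemma ALIVE_mono (h : s ≤ t) : ALIVE α σ s f e ⊆ ALIVE α σ t f e := fun i hi => by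
  simp only [mem_ALIVE] at *; exact ⟨⟨hi.1.1.trans_le h, hi.1.2⟩, hi.2⟩

lemma ALIVE_anti (h : f ≤ f') : ALIVE α σ t f' e ⊆ ALIVE α σ t f e := fun i hi => by
  simp only [mem_ALIVE] at *; exact ⟨hi.1, hi.2.1, (h i).trans_lt hi.2.2⟩

lemma normCost_pos (hα : 0 < α) (hN : 2 ≤ N.m * N.c) (r : Request N) : 0 < normCost α r := by
  have := N.two_le_mc hN; have := r.cost_pos
  unfold normCost; positivity

lemma IsMedium.one_lt_normCost (hα : 0 < α) (hN : 2 ≤ N.m * N.c) {r : Request N}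
    (h : IsMedium α r) : 1 < normCost α r := by
  have hm := N.two_le_mc hN
  have h1 := h.1
  unfold IsSmall at h1
  push Not at h1
  unfold normCost
  rw [lt_div_iff₀ hα, one_mul]
  rwa [div_lt_iff₀ (by linarith)] at h1

lemma IsMedium.normCost_le (hα : 0 < α) (hN : 2 ≤ N.m * N.c) {r : Request N}
    (h : IsMedium α r) : normCost α r ≤ 2 * N.mc := by
  have hm := N.two_le_mc hN
  have h1 := h.2
  unfold IsBig at h1
  push Not at h1
  unfold normCost
  rw [div_le_iff₀ hα]
  nlinarith

/-! ### The weights of the fractional algorithm -/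

/-- The weights that occur in the fractional algorithm: apart from medium requests that have
arrived, all weights vanish, and a nonzero weight lies between `1 / (g c)` and `2`. -/
def IsWeighting (α : ℝ) (σ : ℕ → Request N) (t : ℕ) (f : ℕ → ℝ) : Prop :=
  ∀ i, f i = 0 ∨ (i < t ∧ IsMedium α (σ i) ∧ N.startWeight ≤ f i ∧ f i ≤ 2)

lemma IsWeighting.nonneg (hN : 2 ≤ N.m * N.c) (hf : IsWeighting α σ t f) (i : ℕ) : 0 ≤ f i := by
  rcases hf i with h | h
  · exact h.ge
  · exact (N.startWeight_pos hN).le.trans h.2.2.1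

lemma IsWeighting.le_two (hf : IsWeighting α σ t f) (i : ℕ) : f i ≤ 2 := by
  rcases hf i with h | h
  · rw [h]; norm_num
  · exact h.2.2.2

lemma IsWeighting.eq_zero_of_le (hf : IsWeighting α σ t f) {i : ℕ} (hi : t ≤ i) : f i = 0 :=
  (hf i).resolve_right fun h => absurd h.1 (by omega)

lemma IsWeighting.eq_zero_of_not_isMedium (hf : IsWeighting α σ t f) {i : ℕ}
    (hi : ¬ IsMedium α (σ i)) : f i = 0 :=
  (hf i).resolve_right fun h => hi h.2.1

lemma IsWeighting.mono (hf : IsWeighting α σ s f) (h : s ≤ t) : IsWeighting α σ t f := fun i =>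
  (hf i).imp_right fun hi => ⟨hi.1.trans_le h, hi.2⟩

/-- Integrality: a violated requirement makes `n_e` positive, and `n_e` is an integer. -/
lemma one_le_excess (hN : 2 ≤ N.m * N.c) (hf : IsWeighting α σ t f)
    (h : ¬ Satisfied α σ t e f) : 1 ≤ excess α σ t f e := by
  unfold Satisfied at h
  push Not at h
  have h0 : 0 < excess α σ t f e :=
    (Finset.sum_nonneg fun i _ => hf.nonneg hN i).trans_lt h
  have hz : excess α σ t f e =
      (((ALIVE α σ t f e).card - (N.cap e - (BIG α σ t e).card) : ℤ) : ℝ) := by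
    simp [excess]
  rw [hz] at h0 ⊢
  have : (0 : ℤ) < (ALIVE α σ t f e).card - (N.cap e - (BIG α σ t e).card) := by exact_mod_cast h0
  exact_mod_cast this

lemma IsWeighting.ite_eq_max (hN : 2 ≤ N.m * N.c) (hf : IsWeighting α σ t f) (i : ℕ) :
    (if f i = 0 then 1 / (2 * N.mc * N.c) else f i) = max (f i) N.startWeight := by
  have hu := N.startWeight_pos hN
  rcases hf i with h | h
  · rw [if_pos h, h, max_eq_right hu.le]; rfl
  · rw [if_neg (hu.trans_le h.2.2.1).ne', max_eq_left h.2.2.1]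

lemma augment_of_mem (hN : 2 ≤ N.m * N.c) (hf : IsWeighting α σ t f) {i : ℕ}
    (hi : i ∈ ALIVE α σ t f e) : augment α σ t e f i =
      max (f i) N.startWeight * (1 + 1 / (excess α σ t f e * normCost α (σ i))) := by
  rw [← hf.ite_eq_max hN, augment, if_pos hi]

lemma augment_of_notMem {i : ℕ} (hi : i ∉ ALIVE α σ t f e) : augment α σ t e f i = f i := by
  rw [augment, if_neg hi]

/-- The upper bound means that an augmentation at most doubles a weight. As only weights below 1 are
augmented, none ever exceeds 2. -/
lemma inv_excess_mul_normCost_mem (hα : 0 < α) (hN : 2 ≤ N.m * N.c) (hf : IsWeighting α σ t f)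
    (h : ¬ Satisfied α σ t e f) {i : ℕ} (hi : i ∈ ALIVE α σ t f e) :
    0 < 1 / (excess α σ t f e * normCost α (σ i)) ∧
      1 / (excess α σ t f e * normCost α (σ i)) ≤ 1 := by
  have h1 := one_le_excess hN hf h
  have h2 := (mem_ALIVE.1 hi).2.1.one_lt_normCost hα hN
  refine ⟨by positivity, ?_⟩
  rw [div_le_one (by positivity)]
  nlinarith

lemma le_augment (hα : 0 < α) (hN : 2 ≤ N.m * N.c) (hf : IsWeighting α σ t f)
    (h : ¬ Satisfied α σ t e f) : f ≤ augment α σ t e f := fun i => by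
  by_cases hi : i ∈ ALIVE α σ t f e
  · rw [augment_of_mem hN hf hi]
    have h1 := inv_excess_mul_normCost_mem hα hN hf h hi
    have h2 := N.startWeight_pos hN
    have h3 := le_max_left (f i) N.startWeight
    have h4 := le_max_right (f i) N.startWeight
    nlinarith
  · rw [augment_of_notMem hi]

lemma IsWeighting.augment (hα : 0 < α) (hN : 2 ≤ N.m * N.c) (hf : IsWeighting α σ t f)
    (h : ¬ Satisfied α σ t e f) : IsWeighting α σ t (augment α σ t e f) := fun i => by
  by_cases hi : i ∈ ALIVE α σ t f e
  · have hi' := mem_ALIVE.1 hi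
    right
    refine ⟨hi'.1.1, hi'.2.1, ?_⟩
    rw [augment_of_mem hN hf hi]
    have h1 := inv_excess_mul_normCost_mem hα hN hf h hi
    have h2 := N.startWeight_pos hN
    have h4 := le_max_right (f i) N.startWeight
    have h5 : max (f i) N.startWeight ≤ 1 := max_le hi'.2.2.le (N.startWeight_le_one hN)
    constructor <;> nlinarith
  · rw [augment_of_notMem hi]; exact hf i

/-! ### The potential -/

/-- The logarithms of the weights of the requests in `R`, scaled by the costs. -/
noncomputable def potential (α : ℝ) (σ : ℕ → Request N) (R : Finset ℕ) (f : ℕ → ℝ) : ℝ :=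
  ∑ i ∈ R, normCost α (σ i) * Real.log (max (f i) N.startWeight / N.startWeight)

/-- If all requests in `R` are rejected, then the medium requests that are still alive and the big
requests respect the capacities. -/
def Covers (α : ℝ) (σ : ℕ → Request N) (t : ℕ) (R : Finset ℕ) : Prop :=
  ∀ (f : ℕ → ℝ) (e : E), (ALIVE α σ t f e \ R).card + (BIG α σ t e).card ≤ N.cap e

lemma Covers.anti (h : Covers α σ t R) (hst : s ≤ t) : Covers α σ s R := fun f e =>
  (add_le_add (Finset.card_le_card (Finset.sdiff_subset_sdiff (ALIVE_mono hst) subset_rfl))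
    (Finset.card_le_card (BIG_mono hst))).trans (h f e)

/-- This is where the comparison solution enters: whatever the weights are, it has to reject at
least `n_e` of the alive requests through `e`. -/
lemma Covers.excess_le (h : Covers α σ t R) (f : ℕ → ℝ) (e : E) :
    excess α σ t f e ≤ ((ALIVE α σ t f e ∩ R).card : ℝ) := by
  have h1 := h f e
  have h2 := Finset.card_sdiff_add_card_inter (ALIVE α σ t f e) R
  have h1' : ((ALIVE α σ t f e \ R).card : ℝ) + (BIG α σ t e).card ≤ N.cap e := by
    exact_mod_cast h1
  have h2' : ((ALIVE α σ t f e \ R).card : ℝ) + (ALIVE α σ t f e ∩ R).card =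
      (ALIVE α σ t f e).card := by exact_mod_cast h2
  unfold excess
  linarith

/-- Bernoulli's inequality `(1 + 1/q)^q ≥ 2`. It is used with `q = n_e p_i`, where `1 + 1/q` is the
factor of an augmentation. -/
lemma log_two_le_mul_log_one_add_inv {q : ℝ} (hq : 1 ≤ q) :
    Real.log 2 ≤ q * Real.log (1 + 1 / q) := by
  have hq0 : 0 < q := by linarith
  have h := one_add_mul_self_le_rpow_one_add (s := 1 / q) (by have : 0 < 1 / q := by positivity
                                                              linarith) hq
  rw [← Real.log_rpow (by positivity)]
  apply Real.log_le_log (by norm_num)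
  have : 1 + q * (1 / q) = 2 := by field_simp; norm_num
  linarith

/-- Each alive request of `R` gains at least `log 2 / n_e`, there are at least `n_e` of them, and no
other term decreases. -/
lemma potential_augment (hα : 0 < α) (hN : 2 ≤ N.m * N.c) (hf : IsWeighting α σ t f)
    (h : ¬ Satisfied α σ t e f) (hR : Covers α σ t R) :
    potential α σ R f + Real.log 2 ≤ potential α σ R (augment α σ t e f) := by
  have hu := N.startWeight_pos hN
  have hn := one_le_excess hN hf h
  set n := excess α σ t f e with hn_def
  have key : ∀ i ∈ R, (normCost α (σ i) * Real.log (max (f i) N.startWeight / N.startWeight) +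
      if i ∈ ALIVE α σ t f e then Real.log 2 / n else 0) ≤
      normCost α (σ i) * Real.log (max (augment α σ t e f i) N.startWeight / N.startWeight) := by
    intro i _
    have hw : 0 < max (f i) N.startWeight := hu.trans_le (le_max_right _ _)
    split_ifs with hi
    · have hp := (mem_ALIVE.1 hi).2.1.one_lt_normCost hα hN
      have h1 := inv_excess_mul_normCost_mem hα hN hf h hi
      have hq := log_two_le_mul_log_one_add_inv (q := n * normCost α (σ i)) (by nlinarith)
      have hge : max (f i) N.startWeight * (1 + 1 / (n * normCost α (σ i))) ≤
          max (augment α σ t e f i) N.startWeight := by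
        rw [← augment_of_mem hN hf hi]; exact le_max_left _ _
      have hlog : Real.log (max (f i) N.startWeight / N.startWeight) +
          Real.log (1 + 1 / (n * normCost α (σ i))) ≤
          Real.log (max (augment α σ t e f i) N.startWeight / N.startWeight) := by
        rw [← Real.log_mul (by positivity) (by linarith [h1.1])]
        apply Real.log_le_log (mul_pos (by positivity) (by linarith [h1.1]))
        rw [div_mul_eq_mul_div]
        gcongr
      have h2 : Real.log 2 / n ≤ normCost α (σ i) * Real.log (1 + 1 / (n * normCost α (σ i))) := by
        rw [div_le_iff₀ (by linarith)]
        linarith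
      nlinarith
    · rw [augment_of_notMem hi, add_zero]
  have hsum := Finset.sum_le_sum key
  rw [Finset.sum_add_distrib, ← Finset.sum_filter, Finset.sum_const, nsmul_eq_mul] at hsum
  have hcard : n ≤ ((R.filter (· ∈ ALIVE α σ t f e)).card : ℝ) := by
    rw [Finset.filter_mem_eq_inter, Finset.inter_comm]
    exact hR.excess_le f e
  have h2 : Real.log 2 ≤ ((R.filter (· ∈ ALIVE α σ t f e)).card : ℝ) * (Real.log 2 / n) := by
    rw [mul_div_assoc', le_div_iff₀ (by linarith), mul_comm]
    exact mul_le_mul_of_nonneg_right hcard (Real.log_nonneg (by norm_num))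
  unfold potential
  linarith

lemma potential_le (hα : 0 < α) (hN : 2 ≤ N.m * N.c) (hf : IsWeighting α σ t f) :
    potential α σ R f ≤ (∑ i ∈ R, normCost α (σ i)) * Real.log (2 / N.startWeight) := by
  have hu := N.startWeight_pos hN
  rw [Finset.sum_mul]
  refine Finset.sum_le_sum fun i _ => mul_le_mul_of_nonneg_left ?_ (normCost_pos hα hN _).le
  have hw : 0 < max (f i) N.startWeight := hu.trans_le (le_max_right _ _)
  apply Real.log_le_log (by positivity)
  gcongr
  exact max_le (hf.le_two i) (by linarith [N.startWeight_le_one hN])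

/-! ### Weight augmentations for one edge -/

/-- The loop stops at the first satisfied iterate, so every step it performs starts from a violated
requirement. Termination is not needed: if no iterate were satisfied, `sInf ∅ = 0` and the loop
would return `f` itself. -/
lemma processEdge_induction {P : (ℕ → ℝ) → Prop}
    (h : ∀ f, P f → ¬ Satisfied α σ t e f → P (augment α σ t e f)) (hf : P f) :
    P (processEdge α σ t f e) := by
  have key : ∀ k ≤ sInf {k | Satisfied α σ t e ((augment α σ t e)^[k] f)},
      P ((augment α σ t e)^[k] f) := by
    intro k
    induction k with
    | zero => exact fun _ => hf
    | succ k ih =>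
      intro hk
      rw [Function.iterate_succ_apply']
      exact h _ (ih (by omega)) (Nat.notMem_of_lt_sInf (Nat.lt_of_succ_le hk))
  exact key _ le_rfl

lemma foldl_processEdge_induction {P : (ℕ → ℝ) → Prop}
    (h : ∀ e f, P f → ¬ Satisfied α σ t e f → P (augment α σ t e f)) (l : List E) (hf : P f) :
    P (l.foldl (processEdge α σ t) f) := by
  induction l generalizing f with
  | nil => exact hf
  | cons e l ih => exact ih (processEdge_induction (h e) hf)

/-- Termination of the loop: every step adds `log 2` to a potential that is bounded above. -/
lemma satisfied_processEdge (hα : 0 < α) (hN : 2 ≤ N.m * N.c) (hf : IsWeighting α σ t f)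
    (hR : Covers α σ t R) : Satisfied α σ t e (processEdge α σ t f e) := by
  suffices h : {k | Satisfied α σ t e ((augment α σ t e)^[k] f)}.Nonempty from Nat.sInf_mem h
  by_contra hne
  rw [Set.not_nonempty_iff_eq_empty, Set.eq_empty_iff_forall_notMem] at hne
  have key : ∀ k : ℕ, IsWeighting α σ t ((augment α σ t e)^[k] f) ∧
      potential α σ R f + k * Real.log 2 ≤ potential α σ R ((augment α σ t e)^[k] f) := by
    intro k
    induction k with
    | zero => exact ⟨hf, by simp⟩
    | succ k ih =>
      rw [Function.iterate_succ_apply']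
      refine ⟨ih.1.augment hα hN (hne k), ?_⟩
      have := potential_augment hα hN ih.1 (hne k) hR
      push_cast
      linarith [ih.2]
  have hl : 0 < Real.log 2 := Real.log_pos (by norm_num)
  obtain ⟨k, hk⟩ := exists_nat_gt (((∑ i ∈ R, normCost α (σ i)) * Real.log (2 / N.startWeight) -
    potential α σ R f) / Real.log 2)
  rw [div_lt_iff₀ hl] at hk
  linarith [(key k).2, potential_le (R := R) hα hN (key k).1]

/-- A request that dies when the weights grow lowers `n_e` by 1, but had contributed less than 1 to
the old sum. -/
lemma Satisfied.mono (hf' : f ≤ f') (h : Satisfied α σ t e f) : Satisfied α σ t e f' := by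
  have hsub : ALIVE α σ t f' e ⊆ ALIVE α σ t f e := ALIVE_anti hf'
  have h1 : ∑ i ∈ ALIVE α σ t f e \ ALIVE α σ t f' e, f i ≤
      ((ALIVE α σ t f e \ ALIVE α σ t f' e).card : ℝ) := by
    rw [← nsmul_one, ← Finset.sum_const]
    exact Finset.sum_le_sum fun i hi => (mem_ALIVE.1 (Finset.mem_sdiff.1 hi).1).2.2.le
  have h2 := Finset.sum_sdiff (f := f) hsub
  have h3 : ((ALIVE α σ t f e \ ALIVE α σ t f' e).card : ℝ) + (ALIVE α σ t f' e).card =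
      (ALIVE α σ t f e).card := by
    exact_mod_cast Finset.card_sdiff_add_card_eq_card hsub
  have h4 : ∑ i ∈ ALIVE α σ t f' e, f i ≤ ∑ i ∈ ALIVE α σ t f' e, f' i :=
    Finset.sum_le_sum fun i _ => hf' i
  unfold Satisfied excess at *
  linarith

/-- An edge is either still to be processed or already satisfied, and by monotonicity the work on
other edges cannot destroy the latter. -/
lemma satisfied_foldl (hα : 0 < α) (hN : 2 ≤ N.m * N.c) (hf : IsWeighting α σ t f)
    (hR : Covers α σ t R) (l : List E) (he : e ∈ l ∨ Satisfied α σ t e f) :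
    Satisfied α σ t e (l.foldl (processEdge α σ t) f) := by
  have stable : ∀ e' f, (IsWeighting α σ t f ∧ Satisfied α σ t e f) → ¬ Satisfied α σ t e' f →
      IsWeighting α σ t (augment α σ t e' f) ∧ Satisfied α σ t e (augment α σ t e' f) :=
    fun e' f h h' => ⟨h.1.augment hα hN h', h.2.mono (le_augment hα hN h.1 h')⟩
  induction l generalizing f with
  | nil => exact he.resolve_left (by simp)
  | cons a l ih =>
    have hw : IsWeighting α σ t (processEdge α σ t f a) :=
      processEdge_induction (fun f h h' => h.augment hα hN h') hf
    refine ih hw ?_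
    rcases he with he | he
    · rcases List.mem_cons.1 he with rfl | he
      · exact Or.inr (satisfied_processEdge hα hN hf hR)
      · exact Or.inl he
    · exact Or.inr (processEdge_induction (stable a) ⟨hf, he⟩).2

/-! ### The run of the fractional algorithm -/

lemma isWeighting_foldl (hα : 0 < α) (hN : 2 ≤ N.m * N.c) (hf : IsWeighting α σ t f)
    (l : List E) : IsWeighting α σ t (l.foldl (processEdge α σ t) f) ∧
      f ≤ l.foldl (processEdge α σ t) f :=
  foldl_processEdge_induction (P := fun f' => IsWeighting α σ t f' ∧ f ≤ f')
    (fun _ _ h h' => ⟨h.1.augment hα hN h', h.2.trans (le_augment hα hN h.1 h')⟩) l ⟨hf, le_rfl⟩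

lemma isWeighting_fracWeight (hα : 0 < α) (hN : 2 ≤ N.m * N.c) (t : ℕ) :
    IsWeighting α σ t (fracWeight α σ t) := by
  induction t with
  | zero => exact fun i => Or.inl rfl
  | succ t ih => exact (isWeighting_foldl hα hN (ih.mono t.le_succ) _).1

lemma fracWeight_le_succ (hα : 0 < α) (hN : 2 ≤ N.m * N.c) (t : ℕ) :
    fracWeight α σ t ≤ fracWeight α σ (t + 1) :=
  (isWeighting_foldl hα hN ((isWeighting_fracWeight hα hN t).mono t.le_succ) _).2

lemma REQ_succ_of_notMem (h : e ∉ (σ t).path) : REQ σ (t + 1) e = REQ σ t e := by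
  ext i
  simp only [mem_REQ]
  constructor
  · rintro ⟨h1, h2⟩
    refine ⟨lt_of_le_of_ne (by omega) ?_, h2⟩
    rintro rfl
    exact h h2
  · rintro ⟨h1, h2⟩
    exact ⟨by omega, h2⟩

lemma satisfied_fracWeight_of_covers (hα : 0 < α) (hN : 2 ≤ N.m * N.c) (hR : Covers α σ t R)
    (e : E) : Satisfied α σ t e (fracWeight α σ t) := by
  induction t with
  | zero => simp [Satisfied, excess, ALIVE, BIG, REQ]
  | succ t ih =>
    refine satisfied_foldl hα hN ((isWeighting_fracWeight hα hN t).mono t.le_succ) hR _ ?_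
    by_cases he : e ∈ (σ t).path
    · exact Or.inl he
    · right
      have := ih (hR.anti t.le_succ)
      simpa only [Satisfied, excess, ALIVE, BIG, REQ_succ_of_notMem he] using this

/-- Rejecting everything is a legitimate comparison set as far as termination is concerned, whatever
it costs. -/
lemma covers_range (hb : ∀ e, (BIG α σ t e).card ≤ N.cap e) :
    Covers α σ t (Finset.range t) := fun f e => by
  have : ALIVE α σ t f e \ Finset.range t = ∅ := by
    rw [Finset.sdiff_eq_empty_iff_subset]
    exact fun i hi => Finset.mem_range.2 (mem_ALIVE.1 hi).1.1
  rw [this, Finset.card_empty, zero_add]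
  exact hb e

lemma satisfied_fracWeight (hα : 0 < α) (hN : 2 ≤ N.m * N.c)
    (hb : ∀ e, (BIG α σ t e).card ≤ N.cap e) (e : E) :
    Satisfied α σ t e (fracWeight α σ t) :=
  satisfied_fracWeight_of_covers hα hN (covers_range hb) e

/-! ### The cost of the fractional solution -/

/-- The alive requests through `e` that have weight `0`. -/
noncomputable def unweighted (α : ℝ) (σ : ℕ → Request N) (t : ℕ) (f : ℕ → ℝ) (e : E) : Finset ℕ :=
  (ALIVE α σ t f e).filter fun i => f i = 0

open Classical in
/-- The cost of the fractional solution in terms of the normalized costs. -/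
noncomputable def normFracCost (α : ℝ) (σ : ℕ → Request N) (t : ℕ) (f : ℕ → ℝ) : ℝ :=
  ∑ i ∈ (Finset.range t).filter (fun i => IsMedium α (σ i)), min (f i) 1 * normCost α (σ i)

/-- The alive weights sum to at most the number of nonzero ones, while the requirement asks for at
least `|ALIVE_e| - c_e`. This limits how many requests can later be lifted from weight 0 at once. -/
lemma card_unweighted_le (h : Satisfied α σ t e f) :
    (unweighted α σ t f e).card ≤ N.cap e := by
  have h1 : ∑ i ∈ ALIVE α σ t f e, f i ≤
      ∑ i ∈ ALIVE α σ t f e, if f i = 0 then (0 : ℝ) else 1 := by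
    refine Finset.sum_le_sum fun i hi => ?_
    split_ifs with h0
    · exact h0.le
    · exact (mem_ALIVE.1 hi).2.2.le
  have h2 : ∑ i ∈ ALIVE α σ t f e, (if f i = 0 then (0 : ℝ) else 1) =
      (ALIVE α σ t f e).card - (unweighted α σ t f e).card := by
    have : ∀ i ∈ ALIVE α σ t f e, (if f i = 0 then (0 : ℝ) else 1) =
        1 - if f i = 0 then (1 : ℝ) else 0 := fun i _ => by split_ifs <;> norm_num
    rw [Finset.sum_congr rfl this, Finset.sum_sub_distrib, Finset.sum_boole]
    simp [unweighted]
  have h3 : (0 : ℝ) ≤ (BIG α σ t e).card := by positivity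
  unfold Satisfied excess at h
  have : ((unweighted α σ t f e).card : ℝ) ≤ N.cap e := by linarith
  exact_mod_cast this

lemma unweighted_anti (hN : 2 ≤ N.m * N.c) (hf : IsWeighting α σ t f) (h : f ≤ f')  :
    unweighted α σ t f' e ⊆ unweighted α σ t f e := fun i hi => by
  unfold unweighted at *
  rw [Finset.mem_filter] at *
  exact ⟨ALIVE_anti h hi.1, le_antisymm ((h i).trans hi.2.le) (hf.nonneg hN i)⟩

/-- The multiplication adds `f i / n_e` to the cost of each weighted request, at most 1 in total
because the requirement is violated. Lifting at most `2c` requests from weight 0 adds at most 3. -/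
lemma normFracCost_augment (hα : 0 < α) (hN : 2 ≤ N.m * N.c) (hf : IsWeighting α σ t f)
    (h : ¬ Satisfied α σ t e f) (hz : (unweighted α σ t f e).card ≤ 2 * N.c) :
    normFracCost α σ t (augment α σ t e f) ≤ normFracCost α σ t f + 4 := by
  classical
  have hu := N.startWeight_pos hN
  have hn := one_le_excess hN hf h
  have hmc := N.two_le_mc hN
  have hc := N.one_le_c hN
  set n := excess α σ t f e with hn_def
  -- A lifted request costs `1 / (g c)` times a normalized cost of at most `g`, plus at most
  -- `startWeight` from the multiplication that follows.
  set d : ℝ := 1 / N.c + N.startWeight with hd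
  have hd0 : 0 ≤ d := by positivity
  have key : ∀ i ∈ (Finset.range t).filter (fun i => IsMedium α (σ i)),
      min (augment α σ t e f i) 1 * normCost α (σ i) ≤ min (f i) 1 * normCost α (σ i) +
        if i ∈ ALIVE α σ t f e then (f i / n + if f i = 0 then d else 0) else 0 := by
    intro i hi
    split_ifs with hA h0
    · have hp := (mem_ALIVE.1 hA).2.1.one_lt_normCost hα hN
      have hp' := (mem_ALIVE.1 hA).2.1.normCost_le hα hN
      rw [h0, augment_of_mem hN hf hA, h0, max_eq_right hu.le]
      have : min (N.startWeight * (1 + 1 / (n * normCost α (σ i)))) 1 * normCost α (σ i) ≤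
          (N.startWeight * (1 + 1 / (n * normCost α (σ i)))) * normCost α (σ i) :=
        mul_le_mul_of_nonneg_right (min_le_left _ _) (by linarith)
      have h3 : (N.startWeight * (1 + 1 / (n * normCost α (σ i)))) * normCost α (σ i) =
          N.startWeight * normCost α (σ i) + N.startWeight / n := by
        have : n ≠ 0 := by linarith
        have : normCost α (σ i) ≠ 0 := by linarith
        field_simp
      have h4 : N.startWeight * normCost α (σ i) ≤ 1 / N.c := by
        calc N.startWeight * normCost α (σ i) ≤ N.startWeight * (2 * N.mc) := by gcongr
          _ = 1 / N.c := by unfold Network.startWeight; field_simp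
      have h5 : N.startWeight / n ≤ N.startWeight := div_le_self hu.le hn
      simp only [zero_le_one, min_eq_left, zero_mul, zero_div, zero_add]
      linarith
    · have hA' := mem_ALIVE.1 hA
      have hp := hA'.2.1.one_lt_normCost hα hN
      rw [augment_of_mem hN hf hA, ← hf.ite_eq_max hN, if_neg h0, min_eq_left hA'.2.2.le]
      have : min (f i * (1 + 1 / (n * normCost α (σ i)))) 1 * normCost α (σ i) ≤
          (f i * (1 + 1 / (n * normCost α (σ i)))) * normCost α (σ i) :=
        mul_le_mul_of_nonneg_right (min_le_left _ _) (by linarith)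
      have h3 : (f i * (1 + 1 / (n * normCost α (σ i)))) * normCost α (σ i) =
          f i * normCost α (σ i) + f i / n := by
        have : n ≠ 0 := by linarith
        have : normCost α (σ i) ≠ 0 := by linarith
        field_simp
      linarith
    · rw [augment_of_notMem hA, add_zero]
  have hsum := Finset.sum_le_sum key
  rw [Finset.sum_add_distrib] at hsum
  have hsub : ((Finset.range t).filter (fun i => IsMedium α (σ i))).filter
      (· ∈ ALIVE α σ t f e) = ALIVE α σ t f e := by
    ext i
    simp only [Finset.mem_filter, Finset.mem_range, mem_ALIVE]
    tauto
  rw [← Finset.sum_filter, hsub, Finset.sum_add_distrib, ← Finset.sum_div,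
    ← Finset.sum_filter, Finset.sum_const, nsmul_eq_mul] at hsum
  have h1 : (∑ i ∈ ALIVE α σ t f e, f i) / n ≤ 1 := by
    rw [div_le_one (by linarith)]
    unfold Satisfied at h
    linarith
  have h2 : ((unweighted α σ t f e).card : ℝ) * d ≤ 3 := by
    have hz' : ((unweighted α σ t f e).card : ℝ) ≤ 2 * N.c := by exact_mod_cast hz
    calc ((unweighted α σ t f e).card : ℝ) * d ≤ 2 * N.c * d := by gcongr
      _ = 2 + 1 / N.mc := by rw [hd]; unfold Network.startWeight; field_simp
      _ ≤ 3 := by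
        have : 1 / N.mc ≤ 1 := by rw [div_le_one (by linarith)]; linarith
        linarith
  unfold normFracCost
  unfold unweighted at h2
  linarith

lemma normFracCost_succ (hf : IsWeighting α σ t f) :
    normFracCost α σ (t + 1) f = normFracCost α σ t f := by
  classical
  unfold normFracCost
  rw [Finset.range_add_one, Finset.filter_insert]
  split_ifs
  · rw [Finset.sum_insert (by simp), hf.eq_zero_of_le le_rfl]
    simp
  · rfl

/-- Amortization: each augmentation pays for a cost increase of at most 4 with a potential increase
of at least `log 2`. -/
lemma normFracCost_le_potential (hα : 0 < α) (hN : 2 ≤ N.m * N.c) (hR : Covers α σ t R) :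
    normFracCost α σ t (fracWeight α σ t) * Real.log 2 ≤
      4 * potential α σ R (fracWeight α σ t) := by
  induction t with
  | zero =>
    have hu := N.startWeight_pos hN
    simp [normFracCost, potential, fracWeight, max_eq_right hu.le, div_self hu.ne']
  | succ t ih =>
    have hw := isWeighting_fracWeight (σ := σ) hα hN t
    have hR' := hR.anti t.le_succ
    -- At most `c_e` requests of weight 0 were left by the previous round, the arrival adds at most
    -- one, and `c_e + 1 ≤ 2c`.
    have hz : ∀ e, (unweighted α σ (t + 1) (fracWeight α σ t) e).card ≤ 2 * N.c := by
      intro e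
      have h1 := card_unweighted_le (satisfied_fracWeight_of_covers hα hN hR' e)
      have h2 : unweighted α σ (t + 1) (fracWeight α σ t) e ⊆
          insert t (unweighted α σ t (fracWeight α σ t) e) := by
        intro i hi
        simp only [unweighted, Finset.mem_filter, mem_ALIVE, Finset.mem_insert] at *
        rcases (Nat.lt_succ_iff_lt_or_eq.1 hi.1.1.1) with h | h
        · right; tauto
        · exact Or.inl h
      have h3 := (Finset.card_le_card h2).trans (Finset.card_insert_le _ _)
      have h4 := N.cap_le_c e
      have h5 := N.cap_pos e
      omega
    refine (foldl_processEdge_induction (P := fun f => IsWeighting α σ (t + 1) f ∧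
      (∀ e, (unweighted α σ (t + 1) f e).card ≤ 2 * N.c) ∧
      normFracCost α σ (t + 1) f * Real.log 2 ≤ 4 * potential α σ R f) ?_ (σ t).path
      ⟨hw.mono t.le_succ, hz, ?_⟩).2.2
    · intro e f hf hs
      refine ⟨hf.1.augment hα hN hs, fun e' => (Finset.card_le_card
        (unweighted_anti hN hf.1 (le_augment hα hN hf.1 hs))).trans (hf.2.1 e'), ?_⟩
      have h1 := potential_augment hα hN hf.1 hs hR
      have h2 := normFracCost_augment hα hN hf.1 hs (hf.2.1 e)
      have h3 : 0 < Real.log 2 := Real.log_pos (by norm_num)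
      nlinarith [hf.2.2]
    · rw [normFracCost_succ hw]
      exact ih hR'

lemma fracCost_eq (hα : 0 < α) (hN : 2 ≤ N.m * N.c) :
    fracCost α σ t = α / N.mc * normFracCost α σ t (fracWeight α σ t) := by
  have := N.two_le_mc hN
  unfold fracCost normFracCost normCost
  rw [Finset.mul_sum]
  refine Finset.sum_congr rfl fun i _ => ?_
  field_simp

lemma log_two_div_startWeight_le (hN : 2 ≤ N.m * N.c) :
    Real.log (2 / N.startWeight) ≤ 4 * Real.log N.mc := by
  have hmc := N.two_le_mc hN
  have hc := N.one_le_c hN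
  have h1 : 2 / N.startWeight ≤ N.mc ^ 4 := by
    have h2 : 2 / N.startWeight = 4 * N.mc * N.c := by
      unfold Network.startWeight; field_simp; norm_num
    rw [h2]
    have h3 : 4 * N.mc * N.c ≤ 4 * N.mc * N.mc := by gcongr; exact N.c_le_mc hN
    have h4 : (4 : ℝ) ≤ N.mc ^ 2 := by nlinarith
    nlinarith [mul_le_mul_of_nonneg_right h4 (sq_nonneg N.mc)]
  have h5 := Real.log_le_log (div_pos two_pos (N.startWeight_pos hN)) h1
  rw [Real.log_pow] at h5
  exact_mod_cast h5

/-- The fractional solution costs `O(α log (m c))` if some solution of cost at most `α` accepts all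
big requests. -/
lemma fracCost_le (hα : 0 < α) (hN : 2 ≤ N.m * N.c) (hR : Covers α σ t R)
    (hcost : rejectionCost σ R ≤ α) : fracCost α σ t ≤ 24 * α * Real.log N.mc := by
  have hmc := N.two_le_mc hN
  have h1 := normFracCost_le_potential hα hN hR
  have h2 := potential_le (R := R) hα hN (isWeighting_fracWeight (σ := σ) hα hN t)
  have h3 := log_two_div_startWeight_le hN
  have hL := N.log_pos hN
  have h4 : ∑ i ∈ R, normCost α (σ i) ≤ N.mc := by
    unfold normCost
    rw [← Finset.sum_div, ← Finset.sum_mul, div_le_iff₀ hα, mul_comm N.mc]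
    exact mul_le_mul_of_nonneg_right hcost (by linarith)
  have h5 : 0 ≤ ∑ i ∈ R, normCost α (σ i) :=
    Finset.sum_nonneg fun i _ => (normCost_pos hα hN _).le
  have h6 : (∑ i ∈ R, normCost α (σ i)) * Real.log (2 / N.startWeight) ≤
      N.mc * (4 * Real.log N.mc) :=
    (mul_le_mul_of_nonneg_left h3 h5).trans (mul_le_mul_of_nonneg_right h4 (by linarith))
  have h7 : normFracCost α σ t (fracWeight α σ t) * Real.log 2 ≤ 16 * N.mc * Real.log N.mc := by
    linarith
  -- The constant 24 is `4 * 4 / (2 / 3)`: cost per augmentation, exponent in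
  -- `log_two_div_startWeight_le`, lower bound for `log 2`.
  have h8 : (2 : ℝ) / 3 ≤ Real.log 2 := by linarith [Real.log_two_gt_d9]
  have h9 : 0 ≤ normFracCost α σ t (fracWeight α σ t) := Finset.sum_nonneg fun i _ =>
    mul_nonneg (le_min ((isWeighting_fracWeight hα hN t).nonneg hN i) zero_le_one)
      (normCost_pos hα hN _).le
  rw [fracCost_eq hα hN]
  have h10 : normFracCost α σ t (fracWeight α σ t) ≤ 24 * N.mc * Real.log N.mc := by nlinarith
  calc α / N.mc * normFracCost α σ t (fracWeight α σ t) ≤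
      α / N.mc * (24 * N.mc * Real.log N.mc) := by gcongr
    _ = 24 * α * Real.log N.mc := by field_simp

/-! ### The optimum -/

lemma rejectionCost_mono {S T : Finset ℕ} (h : S ⊆ T) : rejectionCost σ S ≤ rejectionCost σ T :=
  Finset.sum_le_sum_of_subset_of_nonneg h fun i _ _ => (σ i).cost_pos.le

lemma rejectionCost_nonneg (S : Finset ℕ) : 0 ≤ rejectionCost σ S :=
  Finset.sum_nonneg fun i _ => (σ i).cost_pos.le

lemma cost_le_rejectionCost {S : Finset ℕ} {i : ℕ} (hi : i ∈ S) :
    (σ i).cost ≤ rejectionCost σ S :=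
  Finset.single_le_sum (f := fun i => (σ i).cost) (fun i _ => (σ i).cost_pos.le) hi

lemma finite_solutionCosts (σ : ℕ → Request N) (t : ℕ) : {x | ∃ A ⊆ Finset.range t,
    Feasible σ t A ∧ x = rejectionCost σ (Finset.range t \ A)}.Finite := by
  refine ((Finset.range t).powerset.image
    fun A => rejectionCost σ (Finset.range t \ A)).finite_toSet.subset ?_
  rintro x ⟨A, hA, -, rfl⟩
  exact Finset.mem_coe.2 (Finset.mem_image_of_mem _ (Finset.mem_powerset.2 hA))

lemma exists_optimal (σ : ℕ → Request N) (t : ℕ) : ∃ A ⊆ Finset.range t, Feasible σ t A ∧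
    optCost σ t = rejectionCost σ (Finset.range t \ A) :=
  Set.Nonempty.csInf_mem (s := {x | ∃ A ⊆ Finset.range t, Feasible σ t A ∧
    x = rejectionCost σ (Finset.range t \ A)}) ⟨_, ∅, by simp, fun e => by simp, rfl⟩
    (finite_solutionCosts σ t)

lemma optCost_le {A : Finset ℕ} (hA : A ⊆ Finset.range t) (hf : Feasible σ t A) :
    optCost σ t ≤ rejectionCost σ (Finset.range t \ A) :=
  csInf_le (finite_solutionCosts σ t).bddBelow ⟨A, hA, hf, rfl⟩

lemma optCost_nonneg (σ : ℕ → Request N) (t : ℕ) : 0 ≤ optCost σ t := by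
  obtain ⟨A, -, -, h⟩ := exists_optimal σ t
  exact h ▸ rejectionCost_nonneg _

lemma optCost_le_succ (σ : ℕ → Request N) (t : ℕ) : optCost σ t ≤ optCost σ (t + 1) := by
  obtain ⟨A, -, hf, h⟩ := exists_optimal σ (t + 1)
  rw [h]
  refine (optCost_le (A := A ∩ Finset.range t) Finset.inter_subset_right fun e => ?_).trans
    (rejectionCost_mono fun i hi => ?_)
  · exact (Finset.card_le_card (Finset.inter_subset_inter (REQ_mono t.le_succ)
      Finset.inter_subset_left)).trans (hf e)
  · simp only [Finset.mem_sdiff, Finset.mem_range, Finset.mem_inter] at *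
    exact ⟨by omega, fun h => hi.2 ⟨h, hi.1⟩⟩

/-! ### Refuted guesses -/

/-- An optimal solution of cost at most `α` cannot reject a request of cost above `2α`. So it
accepts all big requests, its rejections form a covering set, and `fracCost_le` applies. -/
lemma not_refuted (hN : 2 ≤ N.m * N.c) (hD : 24 ≤ D) (hα : 0 < α) (h : optCost σ t ≤ α) :
    ¬ Refuted D α σ t := by
  obtain ⟨A, hA, hf, hopt⟩ := exists_optimal σ t
  have hR : Covers α σ t (Finset.range t \ A) := by
    intro f e
    rw [← Finset.card_union_of_disjoint]
    · refine (Finset.card_le_card fun i hi => ?_).trans (hf e)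
      simp only [Finset.mem_union, Finset.mem_sdiff, mem_ALIVE, mem_BIG, Finset.mem_range,
        Finset.mem_inter, mem_REQ] at *
      rcases hi with hi | hi
      · exact ⟨hi.1.1, by tauto⟩
      · refine ⟨hi.1, by_contra fun hiA => ?_⟩
        have h1 : i ∈ Finset.range t \ A := by simp [hi.1.1, hiA]
        have h2 := cost_le_rejectionCost (σ := σ) h1
        have h3 := hi.2
        unfold IsBig at h3
        linarith
    · rw [Finset.disjoint_left]
      intro i hi hi'
      exact (mem_ALIVE.1 (Finset.mem_sdiff.1 hi).1).2.1.2 (mem_BIG.1 hi').2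
  rintro (⟨e, he⟩ | hc)
  · have := hR 0 e
    omega
  · have h1 := fracCost_le hα hN hR (hopt ▸ h)
    have h2 : 24 * α * Real.log N.mc ≤ D * α * Real.log N.mc := by
      have := N.log_pos hN
      gcongr
    linarith

lemma doubleUntil_eq (a : ℝ) (σ : ℕ → Request N) (t : ℕ) :
    doubleUntil D a σ t = a ∨ ∃ k : ℕ, doubleUntil D a σ t = 2 * (a * 2 ^ k) ∧
      Refuted D (a * 2 ^ k) σ t := by
  unfold doubleUntil
  rcases h : sInf {k : ℕ | ¬ Refuted D (a * 2 ^ k) σ t} with _ | k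
  · left; simp
  · right
    refine ⟨k, by ring, ?_⟩
    have : k ∉ {k : ℕ | ¬ Refuted D (a * 2 ^ k) σ t} := Nat.notMem_of_lt_sInf (by omega)
    simpa using this

lemma not_refuted_doubleUntil (hN : 2 ≤ N.m * N.c) (hD : 24 ≤ D) (ha : 0 < a) :
    ¬ Refuted D (doubleUntil D a σ t) σ t := by
  refine Nat.sInf_mem (s := {k : ℕ | ¬ Refuted D (a * 2 ^ k) σ t}) ?_
  obtain ⟨k, hk⟩ := pow_unbounded_of_one_lt (optCost σ t / a) one_lt_two
  refine ⟨k, not_refuted hN hD (by positivity) ?_⟩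
  rw [div_lt_iff₀ ha] at hk
  linarith

/-- The value before the last doubling was refuted, hence smaller than the optimum. -/
lemma doubleUntil_le (hN : 2 ≤ N.m * N.c) (hD : 24 ≤ D) (ha : 0 < a)
    (h : a ≤ 2 * optCost σ t) : doubleUntil D a σ t ≤ 2 * optCost σ t := by
  rcases doubleUntil_eq (D := D) a σ t with h1 | ⟨k, h1, h2⟩
  · rwa [h1]
  · rw [h1]
    by_contra! h3
    exact not_refuted hN hD (by positivity) (by linarith) h2

/-! ### The first guess -/

lemma initialGuess_mem (h : ∃ e, Overloaded σ t e) :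
    ∃ e, Overloaded σ t e ∧ ∃ i ∈ REQ σ t e, initialGuess σ t = (σ i).cost := by
  unfold initialGuess
  rw [if_pos h]
  refine Set.Nonempty.csInf_mem
    (s := {x | ∃ e, Overloaded σ t e ∧ ∃ i ∈ REQ σ t e, x = (σ i).cost}) ?_ ?_
  · obtain ⟨e, he⟩ := h
    have : (REQ σ t e).Nonempty := Finset.card_pos.1 (by unfold Overloaded at he; omega)
    obtain ⟨i, hi⟩ := this
    exact ⟨_, e, he, i, hi, rfl⟩
  · refine ((Finset.range t).image fun i => (σ i).cost).finite_toSet.subset ?_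
    rintro x ⟨e, -, i, hi, rfl⟩
    exact Finset.mem_coe.2 (Finset.mem_image_of_mem _ (Finset.mem_range.2 (mem_REQ.1 hi).1))

lemma initialGuess_pos (h : ∃ e, Overloaded σ t e) : 0 < initialGuess σ t := by
  obtain ⟨e, -, i, -, hi⟩ := initialGuess_mem h
  exact hi ▸ (σ i).cost_pos

lemma initialGuess_of_not (h : ¬ ∃ e, Overloaded σ t e) : initialGuess σ t = 0 := by
  unfold initialGuess
  rw [if_neg h]

/-- Every feasible solution rejects some request through each overloaded edge. -/
lemma initialGuess_le_optCost (σ : ℕ → Request N) (t : ℕ) :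
    initialGuess σ t ≤ optCost σ t := by
  by_cases h : ∃ e, Overloaded σ t e
  · obtain ⟨e, he⟩ := h
    obtain ⟨A, hA, hf, hopt⟩ := exists_optimal σ t
    have h1 : ∃ i ∈ REQ σ t e, i ∉ A := by
      by_contra! h1
      have h2 := hf e
      rw [Finset.inter_eq_left.2 h1] at h2
      unfold Overloaded at he
      omega
    obtain ⟨i, hi, hiA⟩ := h1
    have hle : initialGuess σ t ≤ (σ i).cost := by
      unfold initialGuess
      rw [if_pos ⟨e, he⟩]
      refine csInf_le ⟨0, ?_⟩ ⟨e, he, i, hi, rfl⟩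
      rintro x ⟨_, -, j, -, rfl⟩
      exact (σ j).cost_pos.le
    rw [hopt]
    exact hle.trans (cost_le_rejectionCost (by simp [(mem_REQ.1 hi).1, hiA]))
  · rw [initialGuess_of_not h]; exact optCost_nonneg σ t

/-! ### The sequence of guesses -/

lemma initialGuess_nonneg (σ : ℕ → Request N) (t : ℕ) : 0 ≤ initialGuess σ t := by
  by_cases h : ∃ e, Overloaded σ t e
  · exact (initialGuess_pos h).le
  · exact (initialGuess_of_not h).ge

lemma guess_nonneg (D : ℝ) (σ : ℕ → Request N) (t : ℕ) : 0 ≤ guess D σ t := by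
  induction t with
  | zero => exact le_rfl
  | succ t ih =>
    rw [guess, doubleUntil]
    refine mul_nonneg ?_ (by positivity)
    split_ifs
    · exact initialGuess_nonneg σ (t + 1)
    · exact ih

lemma guess_succ_eq_or (D : ℝ) (σ : ℕ → Request N) (t : ℕ) :
    guess D σ (t + 1) = guess D σ t ∨ 2 * guess D σ t ≤ guess D σ (t + 1) := by
  by_cases h : guess D σ t = 0
  -- The value 0 for a missing guess makes the appearance of the first guess count as a doubling.
  · right; rw [h, mul_zero]; exact guess_nonneg D σ _
  · rw [guess, if_neg h]
    refine (doubleUntil_eq _ _ _).imp_right ?_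
    rintro ⟨k, h1, -⟩
    rw [h1]
    have : (1 : ℝ) ≤ 2 ^ k := one_le_pow₀ (by norm_num)
    nlinarith [guess_nonneg D σ t]

lemma guess_le_succ (D : ℝ) (σ : ℕ → Request N) (t : ℕ) :
    guess D σ t ≤ guess D σ (t + 1) := by
  rcases guess_succ_eq_or D σ t with h | h <;> linarith [guess_nonneg D σ t]

lemma guess_mono (D : ℝ) (σ : ℕ → Request N) : Monotone (guess D σ) :=
  monotone_nat_of_le_succ (guess_le_succ D σ)

lemma not_overloaded_of_guess_eq_zero (h : guess D σ t = 0) (e : E) : ¬ Overloaded σ t e := by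
  cases t with
  | zero => simp [Overloaded, REQ]
  | succ t =>
    intro he
    rw [guess, doubleUntil] at h
    have h1 := (mul_eq_zero.1 h).resolve_right (by positivity)
    split_ifs at h1
    · exact (initialGuess_pos ⟨e, he⟩).ne' h1
    · contradiction

lemma guess_le_two_mul_optCost (hN : 2 ≤ N.m * N.c) (hD : 24 ≤ D) (σ : ℕ → Request N) (t : ℕ) :
    guess D σ t ≤ 2 * optCost σ t := by
  induction t with
  | zero => simpa [guess] using optCost_nonneg σ 0
  | succ t ih =>
    have h0 := optCost_nonneg σ (t + 1)
    have h2 : (if guess D σ t = 0 then initialGuess σ (t + 1) else guess D σ t) ≤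
        2 * optCost σ (t + 1) := by
      split_ifs
      · linarith [initialGuess_le_optCost σ (t + 1)]
      · linarith [optCost_le_succ σ t]
    rw [guess]
    rcases (show 0 ≤ if guess D σ t = 0 then initialGuess σ (t + 1) else guess D σ t by
      split_ifs
      · exact initialGuess_nonneg σ _
      · exact guess_nonneg D σ t).eq_or_lt with h3 | h3
    · rw [← h3, doubleUntil, zero_mul]; linarith
    · exact doubleUntil_le hN hD h3 h2

lemma not_refuted_guess (hN : 2 ≤ N.m * N.c) (hD : 24 ≤ D) (h : 0 < guess D σ t) :
    ¬ Refuted D (guess D σ t) σ t := by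
  cases t with
  | zero => simp [guess] at h
  | succ t =>
    rw [guess] at h ⊢
    refine not_refuted_doubleUntil hN hD ?_
    by_contra! h1
    exact h.not_ge (mul_nonpos_of_nonpos_of_nonneg h1 (by positivity))

lemma card_BIG_le (hN : 2 ≤ N.m * N.c) (hD : 24 ≤ D) (h : 0 < guess D σ t) (e : E) :
    (BIG (guess D σ t) σ t e).card ≤ N.cap e := by
  by_contra! h1
  exact not_refuted_guess hN hD h (Or.inl ⟨e, h1⟩)

lemma fracCost_guess_le (hN : 2 ≤ N.m * N.c) (hD : 24 ≤ D) (h : 0 < guess D σ t) :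
    fracCost (guess D σ t) σ t ≤ D * guess D σ t * Real.log N.mc := by
  by_contra! h1
  exact not_refuted_guess hN hD h (Or.inr h1)

/-! ### The weights of the randomized algorithm -/

lemma weight_of_pos (h : 0 < guess D σ t) : weight D σ t = fracWeight (guess D σ t) σ t := by
  rw [weight, if_neg h.ne']

lemma isWeighting_weight (hN : 2 ≤ N.m * N.c) (D : ℝ) (σ : ℕ → Request N) (t : ℕ) :
    IsWeighting (guess D σ t) σ t (weight D σ t) := by
  rcases (guess_nonneg D σ t).eq_or_lt with h | h
  · rw [weight, if_pos h.symm]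
    exact fun i => Or.inl rfl
  · rw [weight_of_pos h]
    exact isWeighting_fracWeight h hN t

lemma weight_le_succ (hN : 2 ≤ N.m * N.c) (h : guess D σ (t + 1) = guess D σ t) :
    weight D σ t ≤ weight D σ (t + 1) := by
  unfold weight
  rw [h]
  split_ifs with h0
  · exact le_rfl
  · exact fracWeight_le_succ (lt_of_le_of_ne (guess_nonneg D σ t) (Ne.symm h0)) hN t

lemma increase_nonneg (hN : 2 ≤ N.m * N.c) (D : ℝ) (σ : ℕ → Request N) (t i : ℕ) :
    0 ≤ increase D σ t i := by
  unfold increase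
  split_ifs with h
  · exact sub_nonneg.2 (weight_le_succ hN h i)
  · exact (isWeighting_weight hN D σ (t + 1)).nonneg hN i

/-- A change of the guess discards the old weight but counts the whole new one, so earlier coins
only give extra chances of rejection. -/
lemma weight_le_sum_increase (hN : 2 ≤ N.m * N.c) (D : ℝ) (σ : ℕ → Request N) (t i : ℕ) :
    weight D σ t i ≤ ∑ s ∈ Finset.range t, increase D σ s i := by
  induction t with
  | zero => simp [weight, guess]
  | succ t ih =>
    rw [Finset.sum_range_succ]
    have h0 : 0 ≤ ∑ s ∈ Finset.range t, increase D σ s i :=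
      Finset.sum_nonneg fun s _ => increase_nonneg hN D σ s i
    unfold increase at *
    split_ifs <;> linarith

/-- The cost of the weights that are in use is `O(α log (m c))`. -/
lemma sum_weight_mul_cost_le (hN : 2 ≤ N.m * N.c) (hD : 24 ≤ D) (σ : ℕ → Request N) (t : ℕ) :
    ∑ i ∈ Finset.range t, weight D σ t i * (σ i).cost ≤
      2 * D * Real.log N.mc * guess D σ t := by
  classical
  rcases (guess_nonneg D σ t).eq_or_lt with h | h
  · rw [← h, weight, if_pos h.symm]; simp
  · have hw := isWeighting_fracWeight (σ := σ) h hN t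
    -- The factor 2 appears because `fracCost` truncates weights at 1, whereas they can reach 2.
    have h1 : ∑ i ∈ Finset.range t, weight D σ t i * (σ i).cost ≤
        2 * fracCost (guess D σ t) σ t := by
      unfold fracCost
      rw [Finset.mul_sum, Finset.sum_filter, weight_of_pos h]
      refine Finset.sum_le_sum fun i _ => ?_
      have hp := (σ i).cost_pos
      split_ifs with hm
      · have h2 : fracWeight (guess D σ t) σ t i ≤
            2 * min (fracWeight (guess D σ t) σ t i) 1 := by
          have := hw.le_two i
          have := hw.nonneg hN i
          rcases min_cases (fracWeight (guess D σ t) σ t i) 1 with h | h <;> linarith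
        nlinarith
      · rw [hw.eq_zero_of_not_isMedium hm, zero_mul]
    linarith [fracCost_guess_le hN hD h]

/-! ### The algorithm is a preemptive online algorithm -/

lemma roundingRejections_subset (D : ℝ) (σ : ℕ → Request N) (ω : Coins) (t : ℕ) :
    roundingRejections D σ ω t ⊆ Finset.range (t + 1) := by
  classical exact Finset.filter_subset _ _

lemma subset_capacityCheck (α : ℝ) (σ : ℕ → Request N) (t : ℕ) (R : Finset ℕ) :
    R ⊆ capacityCheck α σ t R := by
  unfold capacityCheck
  split_ifs
  · exact subset_rfl
  · exact Finset.subset_union_left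
  · exact Finset.subset_insert _ _

lemma capacityCheck_subset (hR : R ⊆ Finset.range (t + 1)) :
    capacityCheck α σ t R ⊆ Finset.range (t + 1) := by
  classical
  unfold capacityCheck
  split_ifs
  · exact hR
  · refine Finset.union_subset hR fun i hi => ?_
    simp only [Finset.mem_filter] at hi
    exact hi.1
  · exact Finset.insert_subset (by simp) hR

lemma randomizedAlgorithm_subset_range (D : ℝ) (σ : ℕ → Request N) (ω : Coins) (t : ℕ) :
    randomizedAlgorithm N D σ ω t ⊆ Finset.range t := by
  induction t with
  | zero => simp [randomizedAlgorithm]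
  | succ t ih =>
    exact capacityCheck_subset (Finset.union_subset (ih.trans (by simp))
      (roundingRejections_subset D σ ω t))

lemma randomizedAlgorithm_subset_succ (D : ℝ) (σ : ℕ → Request N) (ω : Coins) (t : ℕ) :
    randomizedAlgorithm N D σ ω t ⊆ randomizedAlgorithm N D σ ω (t + 1) :=
  Finset.subset_union_left.trans (subset_capacityCheck _ _ _ _)

lemma mem_overCapacity : e ∈ overCapacity σ t R ↔ N.cap e < (REQ σ t e \ R).card := by
  simp [overCapacity]

lemma overCapacity_of_guess_eq_zero (h : guess D σ t = 0) (R : Finset ℕ) :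
    overCapacity σ t R = ∅ := by
  rw [Finset.eq_empty_iff_forall_notMem]
  intro e he
  exact not_overloaded_of_guess_eq_zero h e
    ((mem_overCapacity.1 he).trans_le (Finset.card_le_card Finset.sdiff_subset))

lemma REQ_inter_range_sdiff (R : Finset ℕ) :
    REQ σ t e ∩ (Finset.range t \ R) = REQ σ t e \ R := by
  ext i
  simp only [Finset.mem_inter, mem_REQ, Finset.mem_sdiff, Finset.mem_range]
  tauto

lemma REQ_succ_sdiff_subset (ht : t ∈ R) {S : Finset ℕ} (hS : S ⊆ R) :
    REQ σ (t + 1) e \ R ⊆ REQ σ t e \ S := by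
  intro i hi
  simp only [Finset.mem_sdiff, mem_REQ] at *
  refine ⟨⟨lt_of_le_of_ne (by omega) ?_, hi.1.2⟩, fun h => hi.2 (hS h)⟩
  rintro rfl
  exact hi.2 ht

/-- If a big request makes an edge over capacity, the medium requests there are preempted and the
small ones are already rejected; the remaining big ones fit because the guess is not refuted. If the
new request is rejected, the accepted set only shrinks. -/
lemma feasible_randomizedAlgorithm (hN : 2 ≤ N.m * N.c) (hD : 24 ≤ D) (σ : ℕ → Request N)
    (ω : Coins) (t : ℕ) :
    ∀ e, (REQ σ t e \ randomizedAlgorithm N D σ ω t).card ≤ N.cap e := by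
  classical
  induction t with
  | zero => intro e; simp [REQ]
  | succ t ih =>
    intro e
    rw [randomizedAlgorithm]
    set R := randomizedAlgorithm N D σ ω t ∪ roundingRejections D σ ω t with hR
    unfold capacityCheck
    split_ifs with h1 h2
    · by_contra! h
      have := mem_overCapacity.2 h
      rw [h1] at this
      exact Finset.notMem_empty _ this
    · by_cases he : e ∈ overCapacity σ (t + 1) R
      · have hpos : 0 < guess D σ (t + 1) := by
          refine lt_of_le_of_ne (guess_nonneg D σ _) fun h => h1 ?_
          exact overCapacity_of_guess_eq_zero h.symm R
        refine (Finset.card_le_card fun i hi => ?_).trans (card_BIG_le hN hD hpos e)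
        simp only [Finset.mem_sdiff, Finset.mem_union, Finset.mem_filter, not_or, mem_REQ,
          Finset.mem_range] at hi
        refine mem_BIG.2 ⟨hi.1, by_contra fun hb => ?_⟩
        by_cases hs : IsSmall (guess D σ (t + 1)) (σ i)
        · refine hi.2.1 (Finset.mem_union_right _ ?_)
          exact Finset.mem_filter.2 ⟨Finset.mem_range.2 hi.1.1, Or.inl hs⟩
        · exact hi.2.2 ⟨hi.1.1, ⟨hs, hb⟩, e, he, hi.1.2⟩
      · rw [mem_overCapacity, not_lt] at he
        exact (Finset.card_le_card (Finset.sdiff_subset_sdiff subset_rfl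
          Finset.subset_union_left)).trans he
    · exact (Finset.card_le_card (REQ_succ_sdiff_subset (Finset.mem_insert_self _ _)
        (Finset.subset_union_left.trans (Finset.subset_insert _ _)))).trans (ih e)

/-! ### Dependence on the requests that have arrived -/

lemma REQ_congr (h : ∀ i < t, σ i = σ' i) : REQ σ t e = REQ σ' t e := by
  ext i
  simp only [mem_REQ]
  exact and_congr_right fun hi => by rw [h i hi]

lemma ALIVE_congr (h : ∀ i < t, σ i = σ' i) : ALIVE α σ t f e = ALIVE α σ' t f e := by
  classical
  unfold ALIVE
  rw [REQ_congr h]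
  exact Finset.filter_congr fun i hi => by rw [h i (mem_REQ.1 hi).1]

lemma BIG_congr (h : ∀ i < t, σ i = σ' i) : BIG α σ t e = BIG α σ' t e := by
  classical
  unfold BIG
  rw [REQ_congr h]
  exact Finset.filter_congr fun i hi => by rw [h i (mem_REQ.1 hi).1]

lemma excess_congr (h : ∀ i < t, σ i = σ' i) : excess α σ t f e = excess α σ' t f e := by
  unfold excess
  rw [ALIVE_congr h, BIG_congr h]

lemma augment_congr (h : ∀ i < t, σ i = σ' i) : augment α σ t e = augment α σ' t e := by
  funext f i
  unfold augment
  rw [ALIVE_congr h, excess_congr h]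
  split_ifs with hi h0
  · rw [h i (mem_ALIVE.1 hi).1.1]
  · rw [h i (mem_ALIVE.1 hi).1.1]
  · rfl

lemma processEdge_congr (h : ∀ i < t, σ i = σ' i) : processEdge α σ t = processEdge α σ' t := by
  funext f e
  unfold processEdge Satisfied
  simp only [augment_congr h, ALIVE_congr h, excess_congr h]

lemma fracWeight_congr (h : ∀ i < t, σ i = σ' i) : fracWeight α σ t = fracWeight α σ' t := by
  induction t with
  | zero => rfl
  | succ t ih =>
    rw [fracWeight, fracWeight, processEdge_congr h, ih fun i hi => h i (by omega),
      h t (by omega)]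

lemma refuted_congr (h : ∀ i < t, σ i = σ' i) : Refuted D α σ t ↔ Refuted D α σ' t := by
  classical
  have hc : fracCost α σ t = fracCost α σ' t := by
    unfold fracCost
    rw [fracWeight_congr h, Finset.sum_filter, Finset.sum_filter]
    exact Finset.sum_congr rfl fun i hi => by rw [h i (Finset.mem_range.1 hi)]
  unfold Refuted
  simp only [BIG_congr h, hc]

lemma initialGuess_congr (h : ∀ i < t, σ i = σ' i) : initialGuess σ t = initialGuess σ' t := by
  have hs : {x | ∃ e, Overloaded σ t e ∧ ∃ i ∈ REQ σ t e, x = (σ i).cost} =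
      {x | ∃ e, Overloaded σ' t e ∧ ∃ i ∈ REQ σ' t e, x = (σ' i).cost} := by
    ext x
    unfold Overloaded
    simp only [REQ_congr h, Set.mem_ofPred_eq]
    refine exists_congr fun e => and_congr_right fun _ => exists_congr fun i =>
      and_congr_right fun hi => ?_
    rw [h i (mem_REQ.1 hi).1]
  have ho : (∃ e, Overloaded σ t e) ↔ ∃ e, Overloaded σ' t e := by
    simp only [Overloaded, REQ_congr h]
  unfold initialGuess
  rw [hs]
  by_cases h0 : ∃ e, Overloaded σ t e
  · rw [if_pos h0, if_pos (ho.1 h0)]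
  · rw [if_neg h0, if_neg fun h1 => h0 (ho.2 h1)]

lemma guess_congr (h : ∀ i < t, σ i = σ' i) : guess D σ t = guess D σ' t := by
  induction t with
  | zero => rfl
  | succ t ih =>
    rw [guess, guess, ih fun i hi => h i (by omega), initialGuess_congr h]
    unfold doubleUntil
    simp only [refuted_congr h]

lemma weight_congr (h : ∀ i < t, σ i = σ' i) : weight D σ t = weight D σ' t := by
  unfold weight
  rw [guess_congr h, fracWeight_congr h]

lemma roundingRejections_congr (h : ∀ i < t + 1, σ i = σ' i) (ω : Coins) :
    roundingRejections D σ ω t = roundingRejections D σ' ω t := by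
  classical
  have h' : ∀ i < t, σ i = σ' i := fun i hi => h i (by omega)
  unfold roundingRejections increase
  rw [guess_congr h, weight_congr h, weight_congr h', guess_congr h']
  exact Finset.filter_congr fun i hi => by rw [h i (Finset.mem_range.1 hi)]

lemma capacityCheck_congr (h : ∀ i < t + 1, σ i = σ' i) :
    capacityCheck α σ t R = capacityCheck α σ' t R := by
  classical
  have ho : overCapacity σ (t + 1) R = overCapacity σ' (t + 1) R := by
    ext e
    rw [mem_overCapacity, mem_overCapacity, REQ_congr h]
  unfold capacityCheck
  rw [ho, h t (by omega)]
  congr 3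
  ext i
  simp only [Finset.mem_filter, Finset.mem_range]
  exact and_congr_right fun hi => by rw [h i hi]

lemma randomizedAlgorithm_congr (h : ∀ i < t, σ i = σ' i) (ω : Coins) :
    randomizedAlgorithm N D σ ω t = randomizedAlgorithm N D σ' ω t := by
  induction t with
  | zero => rfl
  | succ t ih =>
    rw [randomizedAlgorithm, randomizedAlgorithm, ih fun i hi => h i (by omega),
      roundingRejections_congr h, capacityCheck_congr h, guess_congr h]

lemma isPreemptiveOnline_randomizedAlgorithm (hN : 2 ≤ N.m * N.c) (hD : 24 ≤ D) :
    IsPreemptiveOnline (randomizedAlgorithm N D) where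
  online _ _ ω _ h := randomizedAlgorithm_congr h ω
  subset_arrived := randomizedAlgorithm_subset_range D
  irrevocable := randomizedAlgorithm_subset_succ D
  feasible σ ω t e := by
    rw [REQ_inter_range_sdiff]
    exact feasible_randomizedAlgorithm hN hD σ ω t e

/-! ### The coins -/

instance : IsProbabilityMeasure coinMeasure := by unfold coinMeasure; infer_instance

/-- No bound `x ≤ 1` is assumed, because the nominal rejection probability `12 δ log mc` may exceed
1. -/
lemma volume_real_le_exp {x : ℝ} (hx : 0 ≤ x) :
    (volume : Measure unitInterval).real {y | x ≤ (y : ℝ)} ≤ Real.exp (-x) := by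
  by_cases h1 : x ≤ 1
  · have : {y : unitInterval | x ≤ (y : ℝ)} = Set.Ici ⟨x, hx, h1⟩ := rfl
    rw [this, Measure.real, unitInterval.volume_Ici, ENNReal.toReal_ofReal (by simpa using h1)]
    linarith [Real.add_one_le_exp (-x)]
  · have : {y : unitInterval | x ≤ (y : ℝ)} = ∅ := by
      rw [Set.eq_empty_iff_forall_notMem]
      intro y hy
      exact h1 (le_trans hy y.2.2)
    rw [this, measureReal_empty]
    exact (Real.exp_pos _).le

lemma volume_real_lt_le {x : ℝ} (hx : 0 ≤ x) :
    (volume : Measure unitInterval).real {y | (y : ℝ) < x} ≤ x := by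
  by_cases h1 : x ≤ 1
  · have : {y : unitInterval | (y : ℝ) < x} = Set.Iio ⟨x, hx, h1⟩ := rfl
    rw [this, Measure.real, unitInterval.volume_Iio, ENNReal.toReal_ofReal hx]
  · exact measureReal_le_one.trans (not_le.1 h1).le

/-- Independence of the coins enters here: the event is a box, so its probability is a product. -/
lemma coinMeasure_real_forall_le {P : Finset (ℕ × ℕ)} {q : ℕ × ℕ → ℝ} (hq : ∀ p, 0 ≤ q p) :
    coinMeasure.real {ω | ∀ p ∈ P, q p ≤ (ω p : ℝ)} ≤ Real.exp (-∑ p ∈ P, q p) := by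
  have h1 : {ω : Coins | ∀ p ∈ P, q p ≤ (ω p : ℝ)} =
      Set.pi P fun p => {y : unitInterval | q p ≤ (y : ℝ)} := rfl
  rw [h1, Measure.real, coinMeasure, Measure.infinitePi_pi, ENNReal.toReal_prod,
    ← Finset.sum_neg_distrib, Real.exp_sum]
  · exact Finset.prod_le_prod (fun _ _ => ENNReal.toReal_nonneg)
      fun p _ => volume_real_le_exp (hq p)
  · exact fun p _ => measurableSet_le measurable_const measurable_subtype_coe

lemma measurableSet_coin_lt (x : ℝ) (p : ℕ × ℕ) : MeasurableSet {ω : Coins | (ω p : ℝ) < x} :=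
  measurableSet_lt (measurable_subtype_coe.comp (measurable_pi_apply p)) measurable_const

lemma measurableSet_le_coin (x : ℝ) (p : ℕ × ℕ) : MeasurableSet {ω : Coins | x ≤ (ω p : ℝ)} :=
  measurableSet_le measurable_const (measurable_subtype_coe.comp (measurable_pi_apply p))

lemma coinMeasure_real_lt_le {x : ℝ} (hx : 0 ≤ x) (p : ℕ × ℕ) :
    coinMeasure.real {ω | (ω p : ℝ) < x} ≤ x := by
  have h1 : {ω : Coins | (ω p : ℝ) < x} =
      Set.pi ({p} : Finset (ℕ × ℕ)) fun _ => {y : unitInterval | (y : ℝ) < x} := by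
    ext ω; simp
  rw [h1, Measure.real, coinMeasure, Measure.infinitePi_pi, Finset.prod_singleton]
  · exact volume_real_lt_le hx
  · exact fun p _ => measurableSet_lt measurable_subtype_coe measurable_const

/-- On `[0, 1]` one has `exp (-y) ≤ 1 / (1 + y) ≤ 1 - y / 2`, and `2 - y / 2 = 2 (1 - y / 4)`. -/
lemma one_add_exp_neg_le {y : ℝ} (h0 : 0 ≤ y) (h1 : y ≤ 1) :
    1 + Real.exp (-y) ≤ 2 * Real.exp (-(y / 4)) := by
  have h2 : Real.exp (-y) ≤ 1 - y / 2 := by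
    have h3 : Real.exp (-y) ≤ 1 / (1 + y) := by
      rw [Real.exp_neg, ← one_div]
      exact one_div_le_one_div_of_le (by linarith) (by linarith [Real.add_one_le_exp y])
    refine h3.trans ?_
    rw [div_le_iff₀ (by linarith)]
    nlinarith
  linarith [Real.add_one_le_exp (-(y / 4))]

open Classical in
/-- The requests of `S` that survive all coin tosses of the rounds before `t`, where request `i` is
rejected in round `s` with probability `q (s, i)`. -/
noncomputable def survivors (q : ℕ × ℕ → ℝ) (t : ℕ) (S : Finset ℕ) (ω : Coins) : Finset ℕ :=
  S.filter fun i => ∀ s < t, q (s, i) ≤ (ω (s, i) : ℝ)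

/-- A Chernoff bound for the number of requests of `S` that are rejected. -/
lemma coinMeasure_real_card_le_survivors {q : ℕ × ℕ → ℝ} (hq : ∀ p, 0 ≤ q p) {S : Finset ℕ}
    {y : ℕ → ℝ} (hy0 : ∀ i ∈ S, 0 ≤ y i) (hy1 : ∀ i ∈ S, y i ≤ 1)
    (hyq : ∀ i ∈ S, y i ≤ ∑ s ∈ Finset.range t, q (s, i)) (k : ℕ) :
    coinMeasure.real {ω | S.card ≤ k + (survivors q t S ω).card} ≤
      2 ^ k * Real.exp (-(∑ i ∈ S, y i) / 4) := by
  classical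
  set W : Finset ℕ → Set Coins := fun T =>
    {ω | ∀ p ∈ Finset.range t ×ˢ T, q p ≤ (ω p : ℝ)} with hW
  have hWm : ∀ T, MeasurableSet (W T) := fun T => by
    have : W T = ⋂ p ∈ Finset.range t ×ˢ T, {ω : Coins | q p ≤ (ω p : ℝ)} := by
      ext ω; simp [hW]
    rw [this]
    exact Finset.measurableSet_biInter _ fun p _ => measurableSet_le_coin _ _
  -- This is `2 ^ |survivors|`, expanded over the subsets `T` that survive entirely. Its expectation
  -- is at most `∏ (1 + exp (-y i))`, and Markov's inequality is applied at the level `2 ^ (|S| -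
  -- k)`.
  set g : Coins → ℝ := fun ω => ∑ T ∈ S.powerset, (W T).indicator 1 ω with hg
  have hgint : Integrable g coinMeasure := integrable_finsetSum _ fun T _ =>
    (integrable_const (1 : ℝ)).indicator (hWm T)
  have hgval : ∀ ω, g ω = 2 ^ (survivors q t S ω).card := by
    intro ω
    have h1 : g ω = ((S.powerset.filter fun T => ω ∈ W T).card : ℝ) := by
      rw [Finset.card_filter]
      push_cast
      simp only [hg, Set.indicator_apply, Pi.one_apply]
    have h2 : (S.powerset.filter fun T => ω ∈ W T) = (survivors q t S ω).powerset := by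
      ext T
      simp only [Finset.mem_filter, Finset.mem_powerset, hW, survivors, Finset.subset_iff,
        Set.mem_ofPred_eq, Finset.mem_product, Finset.mem_range, Prod.forall]
      constructor
      · exact fun h i hi => ⟨h.1 hi, fun s hs => h.2 s i ⟨hs, hi⟩⟩
      · exact fun h => ⟨fun i hi => (h hi).1, fun s i hsi => (h hsi.2).2 s hsi.1⟩
    rw [h1, h2, Finset.card_powerset]
    norm_num
  have hWle : ∀ T ∈ S.powerset, coinMeasure.real (W T) ≤ ∏ i ∈ T, Real.exp (-y i) := by
    intro T hT
    refine (coinMeasure_real_forall_le hq).trans ?_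
    rw [← Real.exp_sum, Finset.sum_neg_distrib, Finset.sum_product_right]
    apply Real.exp_le_exp.2
    exact neg_le_neg (Finset.sum_le_sum fun i hi => hyq i (Finset.mem_powerset.1 hT hi))
  have hint : ∫ ω, g ω ∂coinMeasure ≤ 2 ^ S.card * Real.exp (-(∑ i ∈ S, y i) / 4) := by
    calc ∫ ω, g ω ∂coinMeasure = ∑ T ∈ S.powerset, coinMeasure.real (W T) := by
          change ∫ ω, ∑ T ∈ S.powerset, (W T).indicator (fun _ => (1 : ℝ)) ω ∂coinMeasure = _
          rw [integral_finsetSum _ fun T _ => (integrable_const (1 : ℝ)).indicator (hWm T)]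
          exact Finset.sum_congr rfl fun T _ => integral_indicator_one (hWm T)
      _ ≤ ∑ T ∈ S.powerset, ∏ i ∈ T, Real.exp (-y i) := Finset.sum_le_sum hWle
      _ = ∏ i ∈ S, (1 + Real.exp (-y i)) := (Finset.prod_one_add S).symm
      _ ≤ ∏ i ∈ S, (2 * Real.exp (-(y i / 4))) := Finset.prod_le_prod
          (fun i _ => by positivity) fun i hi => one_add_exp_neg_le (hy0 i hi) (hy1 i hi)
      _ = 2 ^ S.card * Real.exp (-(∑ i ∈ S, y i) / 4) := by
          rw [Finset.prod_mul_distrib, Finset.prod_const, ← Real.exp_sum, Finset.sum_neg_distrib,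
            ← Finset.sum_div, neg_div]
  have hmark := mul_meas_ge_le_integral_of_nonneg (μ := coinMeasure) (f := g)
    (Filter.Eventually.of_forall fun ω => by rw [hgval]; simp) hgint ((2 : ℝ) ^ S.card / 2 ^ k)
  have hset : {ω | S.card ≤ k + (survivors q t S ω).card} ⊆
      {ω | (2 : ℝ) ^ S.card / 2 ^ k ≤ g ω} := by
    intro ω hω
    rw [Set.mem_ofPred_eq] at hω ⊢
    rw [hgval, div_le_iff₀ (by positivity), ← pow_add, add_comm]
    exact pow_le_pow_right₀ (by norm_num) hω
  refine (measureReal_mono hset).trans ?_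
  have h2 : (0 : ℝ) < 2 ^ S.card := by positivity
  have h3 : (0 : ℝ) < 2 ^ k := by positivity
  have h4 := hmark.trans hint
  rw [div_mul_eq_mul_div, div_le_iff₀ h3] at h4
  have h5 : 2 ^ S.card * coinMeasure.real {ω | (2 : ℝ) ^ S.card / 2 ^ k ≤ g ω} ≤
      2 ^ S.card * (2 ^ k * Real.exp (-(∑ i ∈ S, y i) / 4)) := by linarith
  exact le_of_mul_le_mul_left h5 h2

/-! ### Measurability of the algorithm -/

/-- `Finset ℕ` is countable, so it may carry the discrete σ-algebra; then deterministic steps such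
as `capacityCheck` are measurable automatically. -/
lemma measurable_of_measurableSet_mem {F : Coins → Finset ℕ}
    (h : ∀ i, MeasurableSet {ω | i ∈ F ω}) : @Measurable Coins (Finset ℕ) _ ⊤ F := by
  let _ : MeasurableSpace (Finset ℕ) := ⊤
  refine measurable_to_countable' fun B => ?_
  have : F ⁻¹' {B} = ⋂ i, {ω | i ∈ F ω ↔ i ∈ B} := by
    ext ω
    simp [Finset.ext_iff]
  rw [this]
  refine MeasurableSet.iInter fun i => ?_
  by_cases hi : i ∈ B
  · simpa [hi] using h i
  · simp only [hi, iff_false]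
    exact (h i).compl

lemma measurableSet_mem_roundingRejections (D : ℝ) (σ : ℕ → Request N) (t i : ℕ) :
    MeasurableSet {ω | i ∈ roundingRejections D σ ω t} := by
  simp only [roundingRejections, Finset.mem_filter]
  exact (MeasurableSet.const _).inter ((MeasurableSet.const _).union
    ((MeasurableSet.const _).union (measurableSet_coin_lt _ _)))

/-- The requests that have been rejected before the final capacity check of round `t`. -/
noncomputable def rejectedBeforeCheck (D : ℝ) (σ : ℕ → Request N) (ω : Coins) (t : ℕ) :
    Finset ℕ :=
  randomizedAlgorithm N D σ ω t ∪ roundingRejections D σ ω t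

lemma measurable_randomizedAlgorithm (D : ℝ) (σ : ℕ → Request N) (t : ℕ) :
    @Measurable Coins (Finset ℕ) _ ⊤ (fun ω => randomizedAlgorithm N D σ ω t) ∧
      @Measurable Coins (Finset ℕ) _ ⊤ (fun ω => rejectedBeforeCheck D σ ω t) := by
  let _ : MeasurableSpace (Finset ℕ) := ⊤
  have step : ∀ t, Measurable (fun ω => randomizedAlgorithm N D σ ω t) →
      Measurable (fun ω => rejectedBeforeCheck D σ ω t) := fun t h => by
    refine measurable_of_measurableSet_mem fun i => ?_
    simp only [rejectedBeforeCheck, Finset.mem_union]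
    exact (h (show MeasurableSet {A : Finset ℕ | i ∈ A} from trivial)).union
      (measurableSet_mem_roundingRejections D σ t i)
  suffices h : Measurable (fun ω => randomizedAlgorithm N D σ ω t) from ⟨h, step t h⟩
  induction t with
  | zero => exact measurable_const
  | succ t ih =>
    exact (measurable_from_top (f := capacityCheck (guess D σ (t + 1)) σ t)).comp (step t ih)

lemma measurableSet_rejectedBeforeCheck (D : ℝ) (σ : ℕ → Request N) (t : ℕ)
    (p : Finset ℕ → Prop) : MeasurableSet {ω | p (rejectedBeforeCheck D σ ω t)} :=
  (measurable_randomizedAlgorithm D σ t).2 (show MeasurableSet[⊤] {A : Finset ℕ | p A} from trivial)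

/-! ### The probability that a capacity is exceeded -/

lemma randomizedAlgorithm_mono (D : ℝ) (σ : ℕ → Request N) (ω : Coins) :
    Monotone (randomizedAlgorithm N D σ ω) :=
  monotone_nat_of_le_succ (randomizedAlgorithm_subset_succ D σ ω)

lemma roundingRejections_subset_rejectedBeforeCheck (h : s ≤ t) (ω : Coins) :
    roundingRejections D σ ω s ⊆ rejectedBeforeCheck D σ ω t := by
  rcases h.eq_or_lt with rfl | h
  · exact Finset.subset_union_right
  · exact (Finset.subset_union_right.trans (subset_capacityCheck _ _ _ _)).trans
      ((randomizedAlgorithm_mono D σ ω (show s + 1 ≤ t from h)).trans Finset.subset_union_left)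

/-- Coins of rounds before the arrival of a request thus never count against it, so `survivors` may
range over all rounds. -/
lemma increase_eq_zero (hN : 2 ≤ N.m * N.c) {i : ℕ} (h : s < i) : increase D σ s i = 0 := by
  have h1 := (isWeighting_weight hN D σ (s + 1)).eq_zero_of_le (show s + 1 ≤ i by omega)
  have h2 := (isWeighting_weight hN D σ s).eq_zero_of_le (show s ≤ i by omega)
  unfold increase
  rw [h1, h2]
  simp

lemma one_le_twelve_mul_log (hN : 2 ≤ N.m * N.c) : 1 ≤ 12 * Real.log N.mc := by
  linarith [N.log_two_le hN, Real.log_two_gt_d9]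

/-- Only big requests and light medium ones that survived all coins can still be accepted. The light
ones exceed the room left by the big ones by some `k + 1`, the fractional requirement gives them
total weight at least `k + 1`, and the edge is over capacity only if at most `k` of them fall to the
coins. -/
lemma coinMeasure_real_mem_overCapacity_le (hN : 2 ≤ N.m * N.c) (hD : 24 ≤ D)
    (σ : ℕ → Request N) (t : ℕ) (e : E) :
    coinMeasure.real {ω | e ∈ overCapacity σ (t + 1) (rejectedBeforeCheck D σ ω t)} ≤
      1 / N.mc ^ 3 := by
  classical
  have hmc := N.two_le_mc hN
  have hL := N.log_pos hN
  have hL12 := one_le_twelve_mul_log hN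
  rcases (guess_nonneg D σ (t + 1)).eq_or_lt with h0 | hpos
  · simp only [overCapacity_of_guess_eq_zero h0.symm, Finset.notMem_empty]
    rw [show {ω : Coins | False} = ∅ from rfl, measureReal_empty]
    positivity
  set α := guess D σ (t + 1) with hα
  set w := weight D σ (t + 1) with hw
  set S := (REQ σ (t + 1) e).filter fun i => IsMedium α (σ i) ∧ w i < 1 / (12 * Real.log N.mc)
    with hS
  set q : ℕ × ℕ → ℝ := fun p => 12 * increase D σ p.1 p.2 * Real.log N.mc with hq
  have hq0 : ∀ p, 0 ≤ q p := fun p => by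
    have := increase_nonneg hN D σ p.1 p.2
    positivity
  have hw0 : ∀ i, 0 ≤ w i := (isWeighting_weight hN D σ (t + 1)).nonneg hN
  have hsub : ∀ ω, REQ σ (t + 1) e \ rejectedBeforeCheck D σ ω t ⊆
      BIG α σ (t + 1) e ∪ survivors q (t + 1) S ω := by
    intro ω i hi
    rw [Finset.mem_sdiff] at hi
    have hit := (mem_REQ.1 hi.1).1
    have hround : ∀ s ≤ t, i ≤ s → ¬ (IsSmall (guess D σ (s + 1)) (σ i) ∨
        1 / (12 * Real.log N.mc) ≤ weight D σ (s + 1) i ∨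
        (ω (s, i) : ℝ) < 12 * increase D σ s i * Real.log N.mc) := by
      intro s hs his hbad
      refine hi.2 (roundingRejections_subset_rejectedBeforeCheck hs ω ?_)
      exact Finset.mem_filter.2 ⟨Finset.mem_range.2 (by omega), hbad⟩
    have ht := hround t le_rfl (by omega)
    rw [not_or, not_or, not_le] at ht
    by_cases hb : IsBig α (σ i)
    · exact Finset.mem_union_left _ (mem_BIG.2 ⟨mem_REQ.1 hi.1, hb⟩)
    · refine Finset.mem_union_right _ (Finset.mem_filter.2
        ⟨Finset.mem_filter.2 ⟨hi.1, ⟨ht.1, hb⟩, ht.2.1⟩, fun s hs => ?_⟩)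
      rcases lt_or_ge s i with h | h
      · simp only [hq, increase_eq_zero hN h, mul_zero, zero_mul]
        exact (ω (s, i)).2.1
      · exact not_lt.1 fun h' => hround s (by omega) h (Or.inr (Or.inr h'))
  have hcard : ∀ ω, e ∈ overCapacity σ (t + 1) (rejectedBeforeCheck D σ ω t) →
      N.cap e + 1 ≤ (BIG α σ (t + 1) e).card + (survivors q (t + 1) S ω).card := fun ω hω =>
    (mem_overCapacity.1 hω).trans_le
      ((Finset.card_le_card (hsub ω)).trans (Finset.card_union_le _ _))
  rcases le_or_gt (S.card + (BIG α σ (t + 1) e).card) (N.cap e) with hn | hn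
  · have : {ω | e ∈ overCapacity σ (t + 1) (rejectedBeforeCheck D σ ω t)} = ∅ := by
      rw [Set.eq_empty_iff_forall_notMem]
      intro ω hω
      have h1 := hcard ω hω
      have h2 : (survivors q (t + 1) S ω).card ≤ S.card :=
        Finset.card_le_card (Finset.filter_subset _ _)
      omega
    rw [this, measureReal_empty]
    positivity
  · obtain ⟨k, hk⟩ : ∃ k, S.card + (BIG α σ (t + 1) e).card = N.cap e + k + 1 :=
      ⟨S.card + (BIG α σ (t + 1) e).card - N.cap e - 1, by omega⟩
    have hlt : ∀ i ∈ S, 12 * Real.log N.mc * w i ≤ 1 := fun i hi => by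
      have h1 := (Finset.mem_filter.1 hi).2.2
      rw [lt_div_iff₀ (by linarith)] at h1
      linarith
    have hchern := coinMeasure_real_card_le_survivors (t := t + 1) hq0 (S := S)
      (y := fun i => 12 * Real.log N.mc * w i) (fun i _ => by have := hw0 i; positivity) hlt
      (fun i _ => by
        have h1 := weight_le_sum_increase hN D σ (t + 1) i
        calc 12 * Real.log N.mc * w i ≤
            12 * Real.log N.mc * ∑ s ∈ Finset.range (t + 1), increase D σ s i := by gcongr
          _ = _ := by
            rw [Finset.mul_sum]
            exact Finset.sum_congr rfl fun s _ => by simp only [hq]; ring) k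
    have hset : {ω | e ∈ overCapacity σ (t + 1) (rejectedBeforeCheck D σ ω t)} ⊆
        {ω | S.card ≤ k + (survivors q (t + 1) S ω).card} := fun ω hω => by
      have h1 := hcard ω hω
      rw [Set.mem_ofPred_eq]
      omega
    refine (measureReal_mono hset).trans (hchern.trans ?_)
    have hsat := satisfied_fracWeight hpos hN (card_BIG_le hN hD hpos) e
    rw [← weight_of_pos hpos, ← hw] at hsat
    have hSA : S ⊆ ALIVE α σ (t + 1) w e := fun i hi => by
      have h1 := Finset.mem_filter.1 hi
      refine mem_ALIVE.2 ⟨mem_REQ.1 h1.1, h1.2.1, h1.2.2.trans_le ?_⟩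
      rw [div_le_one (by linarith)]
      exact hL12
    -- Dropping the alive requests outside `S` lowers the excess by 1 each, and the sum of the
    -- weights by less than 1 each.
    have hsum : (k : ℝ) + 1 ≤ ∑ i ∈ S, w i := by
      have h1 := Finset.sum_sdiff (f := w) hSA
      have h2 : ((ALIVE α σ (t + 1) w e \ S).card : ℝ) + S.card =
          (ALIVE α σ (t + 1) w e).card := by
        exact_mod_cast Finset.card_sdiff_add_card_eq_card hSA
      have h3 : ∑ i ∈ ALIVE α σ (t + 1) w e \ S, w i ≤
          ((ALIVE α σ (t + 1) w e \ S).card : ℝ) := by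
        rw [← nsmul_one, ← Finset.sum_const]
        exact Finset.sum_le_sum fun i hi => (mem_ALIVE.1 (Finset.mem_sdiff.1 hi).1).2.2.le
      have h4 : (S.card : ℝ) + (BIG α σ (t + 1) e).card = N.cap e + k + 1 := by exact_mod_cast hk
      unfold Satisfied excess at hsat
      linarith
    rw [← Finset.mul_sum]
    -- The 12 of the algorithm divided by the 4 of the Chernoff bound gives the exponent 3. The
    -- factor `2 ^ k` is then absorbed since `2 ≤ (mc)^3`.
    have hexp : Real.exp (-(12 * Real.log N.mc * ∑ i ∈ S, w i) / 4) ≤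
        (1 / N.mc ^ 3) ^ (k + 1) := by
      have h1 : (1 / N.mc ^ 3) ^ (k + 1) = Real.exp (-(3 * Real.log N.mc * (k + 1))) := by
        have h2 : Real.exp (-(3 * Real.log N.mc)) = 1 / N.mc ^ 3 := by
          rw [Real.exp_neg, mul_comm, Real.exp_mul, Real.exp_log (by linarith), ← one_div]
          norm_num
        rw [← h2, ← Real.exp_nat_mul]
        congr 1
        push_cast
        ring
      rw [h1]
      apply Real.exp_le_exp.2
      nlinarith
    calc 2 ^ k * Real.exp (-(12 * Real.log N.mc * ∑ i ∈ S, w i) / 4) ≤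
        2 ^ k * (1 / N.mc ^ 3) ^ (k + 1) := by gcongr
      _ = (2 / N.mc ^ 3) ^ k * (1 / N.mc ^ 3) := by
        rw [pow_succ, div_eq_mul_one_div 2, mul_pow]; ring
      _ ≤ 1 * (1 / N.mc ^ 3) := by
        have h8 : (8 : ℝ) ≤ N.mc ^ 3 := by
          calc (8 : ℝ) = 2 ^ 3 := by norm_num
            _ ≤ N.mc ^ 3 := by gcongr
        gcongr
        apply pow_le_one₀ (by positivity)
        rw [div_le_one (by positivity)]
        linarith
      _ = _ := one_mul _

/-! ### The cost of the capacity checks -/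

lemma rejectionCost_union_le (S T : Finset ℕ) :
    rejectionCost σ (S ∪ T) ≤ rejectionCost σ S + rejectionCost σ T := by
  have h1 := Finset.sum_union_inter (s₁ := S) (s₂ := T) (f := fun i => (σ i).cost)
  have h2 := rejectionCost_nonneg (σ := σ) (S ∩ T)
  unfold rejectionCost at *
  linarith

open Classical in
/-- A bound for the cost of the requests that are rejected by the capacity check of round `t`. -/
noncomputable def checkCost (D : ℝ) (σ : ℕ → Request N) (t : ℕ) : ℝ :=
  2 * guess D σ (t + 1) * ((if IsMedium (guess D σ (t + 1)) (σ t) then 1 else 0) +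
    N.mc * if IsBig (guess D σ (t + 1)) (σ t) then 1 else 0)

lemma checkCost_nonneg (hN : 2 ≤ N.m * N.c) (D : ℝ) (σ : ℕ → Request N) (t : ℕ) :
    0 ≤ checkCost D σ t := by
  have h1 := guess_nonneg D σ (t + 1)
  have h2 := N.two_le_mc hN
  unfold checkCost
  split_ifs <;> positivity

lemma card_biUnion_le_mc {A : E → Finset ℕ}
    (hA : ∀ e, (A e).card ≤ N.cap e) : ((Finset.univ.biUnion A).card : ℝ) ≤ N.mc := by
  refine le_trans ?_ N.sum_cap_le
  exact_mod_cast Finset.card_biUnion_le.trans (Finset.sum_le_sum fun e _ => hA e)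

/-- Preempted requests were accepted in the previous round, so by feasibility there are at most `∑
c_e ≤ mc` of them, each of cost at most `2α`. If the new request is not big, only it can be lost,
and a small one has been rejected already. -/
lemma rejectionCost_capacityCheck_le (hN : 2 ≤ N.m * N.c) (hD : 24 ≤ D) (σ : ℕ → Request N)
    (ω : Coins) (t : ℕ)
    (h : overCapacity σ (t + 1) (rejectedBeforeCheck D σ ω t) ≠ ∅) :
    rejectionCost σ (capacityCheck (guess D σ (t + 1)) σ t (rejectedBeforeCheck D σ ω t) \
      rejectedBeforeCheck D σ ω t) ≤ checkCost D σ t := by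
  classical
  set R := rejectedBeforeCheck D σ ω t with hR
  set α := guess D σ (t + 1) with hα
  have hα0 : 0 ≤ α := guess_nonneg D σ (t + 1)
  unfold capacityCheck
  rw [if_neg h]
  split_ifs with hb
  · set X := (R ∪ (Finset.range (t + 1)).filter fun i =>
      IsMedium α (σ i) ∧ ∃ e ∈ overCapacity σ (t + 1) R, e ∈ (σ i).path) \ R with hX
    have hXmem : ∀ i ∈ X, IsMedium α (σ i) ∧
        i ∈ Finset.univ.biUnion fun e => REQ σ t e \ randomizedAlgorithm N D σ ω t := by
      intro i hi
      simp only [hX, Finset.mem_sdiff, Finset.mem_union, Finset.mem_filter,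
        Finset.mem_range] at hi
      obtain ⟨hit, hm, e, -, he⟩ := hi.1.resolve_left hi.2
      refine ⟨hm, Finset.mem_biUnion.2 ⟨e, Finset.mem_univ e, Finset.mem_sdiff.2
        ⟨mem_REQ.2 ⟨lt_of_le_of_ne (by omega) ?_, he⟩,
          fun h' => hi.2 (Finset.mem_union_left _ h')⟩⟩⟩
      rintro rfl
      exact hm.2 hb
    have hcard : (X.card : ℝ) ≤ N.mc := by
      refine le_trans ?_ (card_biUnion_le_mc (feasible_randomizedAlgorithm hN hD σ ω t))
      exact_mod_cast Finset.card_le_card fun i hi => (hXmem i hi).2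
    have hcost : rejectionCost σ X ≤ X.card * (2 * α) := by
      rw [← nsmul_eq_mul]
      exact Finset.sum_le_card_nsmul _ _ _ fun i hi => not_lt.1 (hXmem i hi).1.2
    have hm : ¬ IsMedium α (σ t) := fun hm => hm.2 hb
    rw [checkCost, ← hα, if_neg hm, if_pos hb]
    nlinarith
  · by_cases hs : IsSmall α (σ t)
    · have ht : t ∈ R := Finset.mem_union_right _
        (Finset.mem_filter.2 ⟨Finset.mem_range.2 (by omega), Or.inl hs⟩)
      rw [Finset.insert_eq_of_mem ht, Finset.sdiff_self]
      simpa [rejectionCost] using checkCost_nonneg hN D σ t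
    · have hsub : insert t R \ R ⊆ {t} := by
        intro i hi
        simp only [Finset.mem_sdiff, Finset.mem_insert, Finset.mem_singleton] at *
        tauto
      refine (rejectionCost_mono hsub).trans ?_
      rw [checkCost, ← hα, if_pos ⟨hs, hb⟩, if_neg hb]
      have h1 := not_lt.1 hb
      simp only [rejectionCost, Finset.sum_singleton]
      linarith

lemma coinMeasure_real_overCapacity_le (hN : 2 ≤ N.m * N.c) (hD : 24 ≤ D) (σ : ℕ → Request N)
    (t : ℕ) :
    coinMeasure.real {ω | overCapacity σ (t + 1) (rejectedBeforeCheck D σ ω t) ≠ ∅} ≤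
      N.m / N.mc ^ 3 := by
  have h1 : {ω | overCapacity σ (t + 1) (rejectedBeforeCheck D σ ω t) ≠ ∅} ⊆
      ⋃ e ∈ (Finset.univ : Finset E),
        {ω | e ∈ overCapacity σ (t + 1) (rejectedBeforeCheck D σ ω t)} := by
    intro ω hω
    obtain ⟨e, he⟩ := Finset.nonempty_iff_ne_empty.2 hω
    simp only [Set.mem_iUnion]
    exact ⟨e, Finset.mem_univ e, he⟩
  refine (measureReal_mono h1 (measure_ne_top _ _)).trans ((measureReal_biUnion_finset_le _ _).trans ?_)
  refine (Finset.sum_le_sum fun e _ =>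
    coinMeasure_real_mem_overCapacity_le hN hD σ t e).trans_eq ?_
  rw [Finset.sum_const, nsmul_eq_mul, Finset.card_univ, mul_one_div]
  rfl

/-! ### The expected cost of the rejections -/

/-- Up to the requests in `B`, which contains all those that are rejected irrespective of the coins,
the cost of the algorithm is caused by the coins and by the capacity checks. -/
lemma rejectionCost_sdiff_le (hN : 2 ≤ N.m * N.c) (hD : 24 ≤ D) (σ : ℕ → Request N) (T : ℕ)
    {B : Finset ℕ} (hB : ∀ s < T, ∀ i ≤ s, (IsSmall (guess D σ (s + 1)) (σ i) ∨
      1 / (12 * Real.log N.mc) ≤ weight D σ (s + 1) i) → i ∈ B) (ω : Coins) :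
    rejectionCost σ (randomizedAlgorithm N D σ ω T \ B) ≤
      ∑ s ∈ Finset.range T, ((∑ i ∈ Finset.range T, (σ i).cost *
        {ω : Coins | (ω (s, i) : ℝ) < 12 * increase D σ s i * Real.log N.mc}.indicator 1 ω) +
        checkCost D σ s * {ω | overCapacity σ (s + 1)
          (rejectedBeforeCheck D σ ω s) ≠ ∅}.indicator 1 ω) := by
  classical
  suffices h : ∀ t ≤ T, rejectionCost σ (randomizedAlgorithm N D σ ω t \ B) ≤
      ∑ s ∈ Finset.range t, ((∑ i ∈ Finset.range T, (σ i).cost *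
        {ω : Coins | (ω (s, i) : ℝ) < 12 * increase D σ s i * Real.log N.mc}.indicator 1 ω) +
        checkCost D σ s * {ω | overCapacity σ (s + 1)
          (rejectedBeforeCheck D σ ω s) ≠ ∅}.indicator 1 ω) from h T le_rfl
  intro t
  induction t with
  | zero => intro _; simp [randomizedAlgorithm, rejectionCost]
  | succ t ih =>
    intro ht
    rw [Finset.sum_range_succ]
    set C := (Finset.range T).filter fun i =>
      (ω (t, i) : ℝ) < 12 * increase D σ t i * Real.log N.mc with hC
    set X := capacityCheck (guess D σ (t + 1)) σ t (rejectedBeforeCheck D σ ω t) \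
      rejectedBeforeCheck D σ ω t with hX
    have hsub : randomizedAlgorithm N D σ ω (t + 1) \ B ⊆
        (randomizedAlgorithm N D σ ω t \ B) ∪ (C ∪ X) := by
      intro i hi
      rw [Finset.mem_sdiff] at hi
      by_cases hiR : i ∈ rejectedBeforeCheck D σ ω t
      · rcases Finset.mem_union.1 hiR with h | h
        · exact Finset.mem_union_left _ (Finset.mem_sdiff.2 ⟨h, hi.2⟩)
        · refine Finset.mem_union_right _ (Finset.mem_union_left _ ?_)
          simp only [roundingRejections, Finset.mem_filter, Finset.mem_range] at h
          have h1 : ¬ (IsSmall (guess D σ (t + 1)) (σ i) ∨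
              1 / (12 * Real.log N.mc) ≤ weight D σ (t + 1) i) := fun h' =>
            hi.2 (hB t (by omega) i (by omega) h')
          exact Finset.mem_filter.2 ⟨Finset.mem_range.2 (by omega), by tauto⟩
      · exact Finset.mem_union_right _ (Finset.mem_union_right _
          (Finset.mem_sdiff.2 ⟨hi.1, hiR⟩))
    have hCcost : rejectionCost σ C = ∑ i ∈ Finset.range T, (σ i).cost *
        {ω : Coins | (ω (t, i) : ℝ) < 12 * increase D σ t i * Real.log N.mc}.indicator 1 ω := by
      rw [rejectionCost, hC, Finset.sum_filter]
      refine Finset.sum_congr rfl fun i _ => ?_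
      simp only [Set.indicator_apply, Set.mem_ofPred_eq, Pi.one_apply, mul_ite, mul_one, mul_zero]
    have hXcost : rejectionCost σ X ≤ checkCost D σ t * {ω | overCapacity σ (t + 1)
          (rejectedBeforeCheck D σ ω t) ≠ ∅}.indicator 1 ω := by
      by_cases h : overCapacity σ (t + 1) (rejectedBeforeCheck D σ ω t) = ∅
      · rw [Set.indicator_of_notMem (by simpa using h), hX, capacityCheck, if_pos h,
          Finset.sdiff_self]
        simp [rejectionCost]
      · rw [Set.indicator_of_mem (by exact h), Pi.one_apply, mul_one]
        exact rejectionCost_capacityCheck_le hN hD σ ω t h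
    have h1 := rejectionCost_mono (σ := σ) hsub
    have h2 := rejectionCost_union_le (σ := σ) (randomizedAlgorithm N D σ ω t \ B) (C ∪ X)
    have h3 := rejectionCost_union_le (σ := σ) C X
    have h4 := ih (by omega)
    linarith

lemma integrable_rejectionCost (D : ℝ) (σ : ℕ → Request N) (t : ℕ) :
    Integrable (fun ω => rejectionCost σ (randomizedAlgorithm N D σ ω t)) coinMeasure := by
  let _ : MeasurableSpace (Finset ℕ) := ⊤
  refine Integrable.of_bound ((measurable_from_top (f := rejectionCost σ)).comp
    (measurable_randomizedAlgorithm D σ t).1).aestronglyMeasurable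
    (rejectionCost σ (Finset.range t)) (Filter.Eventually.of_forall fun ω => ?_)
  rw [Real.norm_of_nonneg (rejectionCost_nonneg _)]
  exact rejectionCost_mono (randomizedAlgorithm_subset_range D σ ω t)

/-- Linearity of expectation suffices: `checkCost` is deterministic, so failures in different rounds
need not be independent. -/
lemma integral_rejectionCost_le (hN : 2 ≤ N.m * N.c) (hD : 24 ≤ D) (σ : ℕ → Request N) (T : ℕ)
    {B : Finset ℕ} (hB : ∀ s < T, ∀ i ≤ s, (IsSmall (guess D σ (s + 1)) (σ i) ∨
      1 / (12 * Real.log N.mc) ≤ weight D σ (s + 1) i) → i ∈ B) :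
    ∫ ω, rejectionCost σ (randomizedAlgorithm N D σ ω T) ∂coinMeasure ≤
      rejectionCost σ B + ((∑ s ∈ Finset.range T, ∑ i ∈ Finset.range T,
        (σ i).cost * (12 * increase D σ s i * Real.log N.mc)) +
      ∑ s ∈ Finset.range T, checkCost D σ s * (N.m / N.mc ^ 3)) := by
  have hL := N.log_pos hN
  set I : ℕ → ℕ → Coins → ℝ := fun s i =>
    {ω : Coins | (ω (s, i) : ℝ) < 12 * increase D σ s i * Real.log N.mc}.indicator 1 with hI
  set J : ℕ → Coins → ℝ := fun s =>
    {ω | overCapacity σ (s + 1) (rejectedBeforeCheck D σ ω s) ≠ ∅}.indicator 1 with hJ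
  have hIm := fun s i => measurableSet_coin_lt (12 * increase D σ s i * Real.log N.mc) (s, i)
  have hJm := fun s => measurableSet_rejectedBeforeCheck D σ s
    fun R => overCapacity σ (s + 1) R ≠ ∅
  have hIint : ∀ s i, Integrable (fun ω => (σ i).cost * I s i ω) coinMeasure := fun s i =>
    ((integrable_const (1 : ℝ)).indicator (hIm s i)).const_mul _
  have hJint : ∀ s, Integrable (fun ω => checkCost D σ s * J s ω) coinMeasure := fun s =>
    ((integrable_const (1 : ℝ)).indicator (hJm s)).const_mul _
  have hIsum : ∀ s, Integrable (fun ω => ∑ i ∈ Finset.range T, (σ i).cost * I s i ω)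
      coinMeasure := fun s => integrable_finsetSum _ fun i _ => hIint s i
  have hsum : Integrable (fun ω => ∑ s ∈ Finset.range T,
      ((∑ i ∈ Finset.range T, (σ i).cost * I s i ω) + checkCost D σ s * J s ω)) coinMeasure :=
    integrable_finsetSum _ fun s _ => (hIsum s).add (hJint s)
  have hle : ∫ ω, rejectionCost σ (randomizedAlgorithm N D σ ω T) ∂coinMeasure ≤
      ∫ ω, (rejectionCost σ B + ∑ s ∈ Finset.range T,
        ((∑ i ∈ Finset.range T, (σ i).cost * I s i ω) + checkCost D σ s * J s ω))
        ∂coinMeasure := by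
    refine integral_mono (integrable_rejectionCost D σ T) ((integrable_const _).add hsum)
      fun ω => ?_
    have h1 : randomizedAlgorithm N D σ ω T ⊆ B ∪ (randomizedAlgorithm N D σ ω T \ B) := by
      rw [Finset.union_sdiff_self_eq_union]; exact Finset.subset_union_right
    have h2 := (rejectionCost_mono (σ := σ) h1).trans (rejectionCost_union_le _ _)
    have h3 := rejectionCost_sdiff_le hN hD σ T hB ω
    exact h2.trans (add_le_add le_rfl h3)
  refine hle.trans ?_
  rw [integral_add (integrable_const _) hsum, integral_const,
    integral_finsetSum (Finset.range T) (f := fun s ω =>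
      (∑ i ∈ Finset.range T, (σ i).cost * I s i ω) + checkCost D σ s * J s ω)
      fun s _ => (hIsum s).add (hJint s), ← Finset.sum_add_distrib]
  simp only [probReal_univ, one_smul]
  refine add_le_add le_rfl (Finset.sum_le_sum fun s _ => ?_)
  rw [integral_add (hIsum s) (hJint s), integral_finsetSum _ fun i _ => hIint s i]
  refine add_le_add (Finset.sum_le_sum fun i _ => ?_) ?_
  · rw [integral_const_mul, hI, integral_indicator_one (hIm s i)]
    have := increase_nonneg hN D σ s i
    exact mul_le_mul_of_nonneg_left (coinMeasure_real_lt_le (by positivity) _)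
      (σ i).cost_pos.le
  · rw [integral_const_mul, hJ, integral_indicator_one (hJm s)]
    exact mul_le_mul_of_nonneg_left (coinMeasure_real_overCapacity_le hN hD σ s)
      (checkCost_nonneg hN D σ s)

/-! ### Summation over the guesses -/

/-- A quantity that, while the guess is `a`, sums up to a potential of at most `C a` sums up to at
most `2 C a` altogether, because the guesses at least double when they change. -/
lemma sum_le_of_doubling {x φ a : ℕ → ℝ} {C : ℝ} {T : ℕ} (hC : 0 ≤ C) (ha : 0 ≤ a 0)
    (hφ0 : 0 ≤ φ 0) (hφ : ∀ t ≤ T, φ t ≤ C * a t)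
    (h : ∀ t < T, (a (t + 1) = a t ∧ x t ≤ φ (t + 1) - φ t) ∨
      (2 * a t ≤ a (t + 1) ∧ x t ≤ φ (t + 1))) :
    ∑ s ∈ Finset.range T, x s ≤ 2 * C * a T := by
  -- The term `C * a t` pays for all finished phases: when the guess changes, `C * a t + φ t ≤ 2 * C
  -- * a t ≤ C * a (t + 1)`.
  have key : ∀ t ≤ T, ∑ s ∈ Finset.range t, x s ≤ C * a t + φ t := by
    intro t
    induction t with
    | zero => intro _; simp only [Finset.range_zero, Finset.sum_empty]; positivity
    | succ t ih =>
      intro ht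
      rw [Finset.sum_range_succ]
      have h1 := ih (by omega)
      have h2 := hφ t (by omega)
      rcases h t (by omega) with ⟨h3, h4⟩ | ⟨h3, h4⟩
      · rw [h3]; linarith
      · nlinarith
  linarith [key T le_rfl, hφ T le_rfl]

lemma sum_increase_mul_cost_le (hN : 2 ≤ N.m * N.c) (hD : 24 ≤ D) (σ : ℕ → Request N) (T : ℕ) :
    ∑ s ∈ Finset.range T, ∑ i ∈ Finset.range T, increase D σ s i * (σ i).cost ≤
      2 * (2 * D * Real.log N.mc) * guess D σ T := by
  have hL := N.log_pos hN
  refine sum_le_of_doubling (φ := fun t => ∑ i ∈ Finset.range T, weight D σ t i * (σ i).cost)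
    (by positivity) (guess_nonneg D σ 0) ?_ ?_ ?_
  · exact Finset.sum_nonneg fun i _ =>
      mul_nonneg ((isWeighting_weight hN D σ 0).nonneg hN i) (σ i).cost_pos.le
  · intro t ht
    refine le_trans (le_of_eq ?_) (sum_weight_mul_cost_le hN hD σ t)
    refine (Finset.sum_subset (Finset.range_subset_range.2 ht) fun i _ hi => ?_).symm
    rw [(isWeighting_weight hN D σ t).eq_zero_of_le (by simpa using hi), zero_mul]
  · intro t _
    by_cases h : guess D σ (t + 1) = guess D σ t
    · refine Or.inl ⟨h, ?_⟩
      rw [← Finset.sum_sub_distrib]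
      refine (Finset.sum_congr rfl fun i _ => ?_).le
      rw [increase, if_pos h, sub_mul]
    · refine Or.inr ⟨(guess_succ_eq_or D σ t).resolve_left h, ?_⟩
      refine (Finset.sum_congr rfl fun i _ => ?_).le
      rw [increase, if_neg h]

lemma exists_mem_path (r : Request N) : ∃ e, e ∈ r.path :=
  List.exists_mem_of_ne_nil _ r.isSimplePath.ne_nil

open Classical in
/-- The number of medium requests through an edge is small while the guess is not refuted. -/
lemma card_medium_REQ_le (hN : 2 ≤ N.m * N.c) (hD : 24 ≤ D) (h : 0 < guess D σ t) (e : E) :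
    (((REQ σ t e).filter fun i => IsMedium (guess D σ t) (σ i)).card : ℝ) ≤
      D * N.mc * Real.log N.mc + N.c := by
  set α := guess D σ t with hα
  have hmc := N.two_le_mc hN
  set w := fracWeight α σ t with hw
  set M := (REQ σ t e).filter fun i => IsMedium α (σ i) with hM
  have hwn : ∀ i, 0 ≤ w i := (isWeighting_fracWeight h hN t).nonneg hN
  have hA : ALIVE α σ t w e ⊆ M := fun i hi => by
    have := mem_ALIVE.1 hi
    exact Finset.mem_filter.2 ⟨mem_REQ.2 this.1, this.2.1⟩
  have hsat := satisfied_fracWeight h hN (card_BIG_le hN hD h) e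
  rw [← hw] at hsat
  -- Dead requests have truncated weight 1, and the requirement bounds the number of alive ones by
  -- `c_e` plus their weight. So `|M|` is at most `c` plus the truncated weight of `M`, each unit of
  -- which costs at least `α / mc`.
  have h1 : ((M \ ALIVE α σ t w e).card : ℝ) + (ALIVE α σ t w e).card = M.card := by
    exact_mod_cast Finset.card_sdiff_add_card_eq_card hA
  have h2 := Finset.sum_sdiff (f := fun i => min (w i) 1) hA
  have h3 : ∑ i ∈ ALIVE α σ t w e, min (w i) 1 = ∑ i ∈ ALIVE α σ t w e, w i :=
    Finset.sum_congr rfl fun i hi => min_eq_left (mem_ALIVE.1 hi).2.2.le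
  have h4 : ∑ i ∈ M \ ALIVE α σ t w e, min (w i) 1 = (M \ ALIVE α σ t w e).card := by
    rw [← nsmul_one, ← Finset.sum_const]
    refine Finset.sum_congr rfl fun i hi => min_eq_right ?_
    rw [Finset.mem_sdiff, hM, Finset.mem_filter, mem_REQ, mem_ALIVE] at hi
    by_contra! h'
    tauto
  have h5 : (α / N.mc) * ∑ i ∈ M, min (w i) 1 ≤ fracCost α σ t := by
    rw [Finset.mul_sum]
    calc ∑ i ∈ M, α / N.mc * min (w i) 1 ≤ ∑ i ∈ M, min (w i) 1 * (σ i).cost := by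
          refine Finset.sum_le_sum fun i hi => ?_
          rw [mul_comm]
          refine mul_le_mul_of_nonneg_left ?_ (le_min (hwn i) zero_le_one)
          exact (not_le.1 (Finset.mem_filter.1 hi).2.1).le
      _ ≤ fracCost α σ t := by
          refine Finset.sum_le_sum_of_subset_of_nonneg (fun i hi => ?_) fun i _ _ =>
            mul_nonneg (le_min (hwn i) zero_le_one) (σ i).cost_pos.le
          have := Finset.mem_filter.1 hi
          exact Finset.mem_filter.2 ⟨Finset.mem_range.2 (mem_REQ.1 this.1).1, this.2⟩
  have h6 := h5.trans (fracCost_guess_le hN hD h)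
  rw [← hα, div_mul_eq_mul_div, div_le_iff₀ (by linarith)] at h6
  have h7 : ∑ i ∈ M, min (w i) 1 ≤ D * N.mc * Real.log N.mc := by
    refine le_of_mul_le_mul_left ?_ h
    linarith
  have h8 : (N.cap e : ℝ) ≤ N.c := by exact_mod_cast N.cap_le_c e
  have h9 : (0 : ℝ) ≤ (BIG α σ t e).card := by positivity
  unfold Satisfied excess at hsat
  linarith

open Classical in
lemma card_medium_le (hN : 2 ≤ N.m * N.c) (hD : 24 ≤ D) (h : 0 < guess D σ t) :
    (((Finset.range t).filter fun i => IsMedium (guess D σ t) (σ i)).card : ℝ) ≤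
      N.m * (D * N.mc * Real.log N.mc + N.c) := by
  have hsub : ((Finset.range t).filter fun i => IsMedium (guess D σ t) (σ i)) ⊆
      Finset.univ.biUnion fun e =>
        (REQ σ t e).filter fun i => IsMedium (guess D σ t) (σ i) := fun i hi => by
    rw [Finset.mem_filter, Finset.mem_range] at hi
    obtain ⟨e, he⟩ := exists_mem_path (σ i)
    exact Finset.mem_biUnion.2 ⟨e, Finset.mem_univ e,
      Finset.mem_filter.2 ⟨mem_REQ.2 ⟨hi.1, he⟩, hi.2⟩⟩
  calc _ ≤ ∑ e, (((REQ σ t e).filter fun i => IsMedium (guess D σ t) (σ i)).card : ℝ) := by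
        exact_mod_cast (Finset.card_le_card hsub).trans Finset.card_biUnion_le
    _ ≤ ∑ _e : E, (D * N.mc * Real.log N.mc + N.c) :=
        Finset.sum_le_sum fun e _ => card_medium_REQ_le hN hD h e
    _ = _ := by rw [Finset.sum_const, nsmul_eq_mul, Finset.card_univ, Network.m]

open Classical in
lemma card_big_le (hN : 2 ≤ N.m * N.c) (hD : 24 ≤ D) (h : 0 < guess D σ t) :
    (((Finset.range t).filter fun i => IsBig (guess D σ t) (σ i)).card : ℝ) ≤ N.mc := by
  refine le_trans ?_ (card_biUnion_le_mc (card_BIG_le hN hD h))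
  refine Nat.cast_le.2 (Finset.card_le_card fun i hi => ?_)
  rw [Finset.mem_filter, Finset.mem_range] at hi
  obtain ⟨e, he⟩ := exists_mem_path (σ i)
  exact Finset.mem_biUnion.2 ⟨e, Finset.mem_univ e, mem_BIG.2 ⟨⟨hi.1, he⟩, hi.2⟩⟩

/-- The count `b` charges 1 for a medium and `mc` for a big request, so it is at most `m (D mc log
mc + c) + (mc)^2`; the failure probability `m / (mc)^3` reduces this to `D log mc + 2`. -/
lemma sum_checkCost_le (hN : 2 ≤ N.m * N.c) (hD : 24 ≤ D) (σ : ℕ → Request N) (T : ℕ) :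
    ∑ s ∈ Finset.range T, checkCost D σ s * (N.m / N.mc ^ 3) ≤
      2 * (2 * (D * Real.log N.mc + 2)) * guess D σ T := by
  classical
  have hL := N.log_pos hN
  have hmc := N.two_le_mc hN
  have hm := N.one_le_m hN
  have hc := N.one_le_c hN
  set b : ℕ → ℝ → ℝ := fun t α =>
    (((Finset.range t).filter fun i => IsMedium α (σ i)).card : ℝ) +
      N.mc * ((Finset.range t).filter fun i => IsBig α (σ i)).card with hb
  have hbsucc : ∀ t α, b (t + 1) α = b t α + ((if IsMedium α (σ t) then 1 else 0) +
      N.mc * if IsBig α (σ t) then 1 else 0) := by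
    intro t α
    simp only [hb, Finset.card_filter, Finset.sum_range_succ]
    push_cast
    ring
  have hb0 : ∀ t α, 0 ≤ b t α := fun t α => by positivity
  refine sum_le_of_doubling
    (φ := fun t => 2 * guess D σ t * b t (guess D σ t) * (N.m / N.mc ^ 3))
    (by positivity) (guess_nonneg D σ 0) (by simp [guess]) ?_ ?_
  · intro t _
    rcases (guess_nonneg D σ t).eq_or_lt with h | h
    · rw [← h]; simp
    · have h1 := card_medium_le hN hD h
      have h2 := card_big_le hN hD h
      have h3 : b t (guess D σ t) ≤
          N.m * (D * N.mc * Real.log N.mc + N.c) + N.mc * N.mc := by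
        simp only [hb]
        gcongr
      have h4 : (N.m * (D * N.mc * Real.log N.mc + N.c) + N.mc * N.mc) * (N.m / N.mc ^ 3) ≤
          D * Real.log N.mc + 2 := by
        rw [mul_div_assoc', div_le_iff₀ (by positivity)]
        have e1 : (N.m : ℝ) * N.m ≤ N.mc * N.mc :=
          mul_le_mul (N.m_le_mc hN) (N.m_le_mc hN) (by linarith) (by linarith)
        have e2 : (N.m : ℝ) * N.mc ≤ N.mc * N.mc := by
          have := N.m_le_mc hN
          gcongr
        have e3 : (N.m : ℝ) * N.c = N.mc := rfl
        have e4 : 0 ≤ D * N.mc * Real.log N.mc := by positivity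
        have e5 : (1 : ℝ) ≤ N.mc := by linarith
        have e6 : N.mc * N.mc ≤ N.mc ^ 3 := by
          nlinarith [mul_nonneg (sub_nonneg.2 e5) (mul_self_nonneg N.mc)]
        have e7 : N.mc * (N.mc * (N.m : ℝ)) ≤ N.mc ^ 3 := by
          nlinarith [mul_le_mul_of_nonneg_left e2 (by linarith : 0 ≤ N.mc)]
        calc (N.m * (D * N.mc * Real.log N.mc + N.c) + N.mc * N.mc) * N.m
            = D * N.mc * Real.log N.mc * (N.m * N.m) + (N.m * N.c) * N.m +
              N.mc * (N.mc * N.m) := by ring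
          _ ≤ D * N.mc * Real.log N.mc * (N.mc * N.mc) + N.mc ^ 3 + N.mc ^ 3 := by
              gcongr
              rw [e3, mul_comm]
              exact e2.trans e6
          _ = (D * Real.log N.mc + 2) * N.mc ^ 3 := by ring
      calc 2 * guess D σ t * b t (guess D σ t) * (N.m / N.mc ^ 3)
          = 2 * guess D σ t * (b t (guess D σ t) * (N.m / N.mc ^ 3)) := by ring
        _ ≤ 2 * guess D σ t * ((N.m * (D * N.mc * Real.log N.mc + N.c) + N.mc * N.mc) *
            (N.m / N.mc ^ 3)) := by gcongr
        _ ≤ 2 * guess D σ t * (D * Real.log N.mc + 2) := by gcongr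
        _ = 2 * (D * Real.log N.mc + 2) * guess D σ t := by ring
  · intro t _
    by_cases h : guess D σ (t + 1) = guess D σ t
    · refine Or.inl ⟨h, le_of_eq ?_⟩
      rw [checkCost, hbsucc, h]
      ring
    · refine Or.inr ⟨(guess_succ_eq_or D σ t).resolve_left h, ?_⟩
      have h1 := guess_nonneg D σ (t + 1)
      have h2 := hb0 t (guess D σ (t + 1))
      rw [checkCost, hbsucc]
      exact mul_le_mul_of_nonneg_right (mul_le_mul_of_nonneg_left (by linarith) (by linarith))
        (by positivity)

/-! ### The requests that are rejected irrespective of the coins -/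

open Classical in
/-- The optimum accepts at most `m c` small requests. -/
lemma rejectionCost_small_le (hN : 2 ≤ N.m * N.c) (hα : 0 ≤ α) (σ : ℕ → Request N) (t : ℕ) :
    rejectionCost σ ((Finset.range t).filter fun i => IsSmall α (σ i)) ≤
      optCost σ t + α := by
  have hmc := N.two_le_mc hN
  obtain ⟨A, hA, hf, hopt⟩ := exists_optimal σ t
  set S := (Finset.range t).filter fun i => IsSmall α (σ i) with hS
  have hsub : S ⊆ (Finset.range t \ A) ∪ (S ∩ A) := fun i hi => by
    have := (Finset.mem_filter.1 hi).1
    by_cases hiA : i ∈ A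
    · exact Finset.mem_union_right _ (Finset.mem_inter.2 ⟨hi, hiA⟩)
    · exact Finset.mem_union_left _ (Finset.mem_sdiff.2 ⟨this, hiA⟩)
  have hcard : ((S ∩ A).card : ℝ) ≤ N.mc := by
    refine le_trans ?_ (card_biUnion_le_mc hf)
    refine Nat.cast_le.2 (Finset.card_le_card fun i hi => ?_)
    rw [Finset.mem_inter, hS, Finset.mem_filter, Finset.mem_range] at hi
    obtain ⟨e, he⟩ := exists_mem_path (σ i)
    exact Finset.mem_biUnion.2 ⟨e, Finset.mem_univ e,
      Finset.mem_inter.2 ⟨mem_REQ.2 ⟨hi.1.1, he⟩, hi.2⟩⟩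
  have hcost : rejectionCost σ (S ∩ A) ≤ (S ∩ A).card * (α / N.mc) := by
    rw [← nsmul_eq_mul]
    exact Finset.sum_le_card_nsmul _ _ _ fun i hi =>
      (Finset.mem_filter.1 (Finset.mem_inter.1 hi).1).2
  have hle : ((S ∩ A).card : ℝ) * (α / N.mc) ≤ α := by
    calc ((S ∩ A).card : ℝ) * (α / N.mc) ≤ N.mc * (α / N.mc) := by gcongr
      _ = α := by field_simp
  have h1 := (rejectionCost_mono (σ := σ) hsub).trans (rejectionCost_union_le _ _)
  linarith

open Classical in
-- A Markov-type bound. Heaviness is measured by the accumulated increases because a weight that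
-- once caused a rejection may later be forgotten.
lemma rejectionCost_heavy_le (hN : 2 ≤ N.m * N.c) (D : ℝ) (σ : ℕ → Request N) (T : ℕ) :
    rejectionCost σ ((Finset.range T).filter fun i =>
      1 / (12 * Real.log N.mc) ≤ ∑ s ∈ Finset.range T, increase D σ s i) ≤
      12 * Real.log N.mc *
        ∑ s ∈ Finset.range T, ∑ i ∈ Finset.range T, increase D σ s i * (σ i).cost := by
  have hL := N.log_pos hN
  rw [rejectionCost, Finset.sum_comm, Finset.mul_sum, Finset.sum_filter]
  refine Finset.sum_le_sum fun i _ => ?_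
  have h0 : 0 ≤ ∑ s ∈ Finset.range T, increase D σ s i :=
    Finset.sum_nonneg fun s _ => increase_nonneg hN D σ s i
  have hp := (σ i).cost_pos
  rw [← Finset.sum_mul]
  split_ifs with h
  · rw [div_le_iff₀ (by positivity)] at h
    nlinarith
  · positivity

/-! ### The competitive ratio -/

lemma integral_rejectionCost_le_optCost (hN : 2 ≤ N.m * N.c) (hD : 24 ≤ D)
    (σ : ℕ → Request N) (T : ℕ) :
    ∫ ω, rejectionCost σ (randomizedAlgorithm N D σ ω T) ∂coinMeasure ≤
      (204 * D + 57) * Real.log N.mc ^ 2 * optCost σ T := by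
  classical
  have hL := N.log_pos hN
  have hmc := N.two_le_mc hN
  set small := (Finset.range T).filter fun i => IsSmall (guess D σ T) (σ i)
  set heavy := (Finset.range T).filter fun i =>
      1 / (12 * Real.log N.mc) ≤ ∑ s ∈ Finset.range T, increase D σ s i
  have hB : ∀ s < T, ∀ i ≤ s, (IsSmall (guess D σ (s + 1)) (σ i) ∨
      1 / (12 * Real.log N.mc) ≤ weight D σ (s + 1) i) → i ∈ small ∪ heavy := by
    -- A request that is small for some guess stays small, since guesses only grow.
    rintro s hs i hi (h | h)
    · refine Finset.mem_union_left _ (Finset.mem_filter.2 ⟨Finset.mem_range.2 (by omega), ?_⟩)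
      exact le_trans h (div_le_div_of_nonneg_right (guess_mono D σ hs) (by linarith))
    · refine Finset.mem_union_right _ (Finset.mem_filter.2 ⟨Finset.mem_range.2 (by omega), ?_⟩)
      refine h.trans ((weight_le_sum_increase hN D σ (s + 1) i).trans ?_)
      exact Finset.sum_le_sum_of_subset_of_nonneg (Finset.range_subset_range.2 hs)
        fun s _ _ => increase_nonneg hN D σ s i
  have h1 := integral_rejectionCost_le hN hD σ T hB
  have h2 := rejectionCost_union_le (σ := σ) small heavy
  have h3 := rejectionCost_small_le hN (guess_nonneg D σ T) σ T
  have h4 := rejectionCost_heavy_le hN D σ T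
  have h5 := sum_increase_mul_cost_le hN hD σ T
  have h6 := sum_checkCost_le hN hD σ T
  have h7 : ∑ s ∈ Finset.range T, ∑ i ∈ Finset.range T,
      (σ i).cost * (12 * increase D σ s i * Real.log N.mc) = 12 * Real.log N.mc *
        ∑ s ∈ Finset.range T, ∑ i ∈ Finset.range T, increase D σ s i * (σ i).cost := by
    simp only [Finset.mul_sum]
    exact Finset.sum_congr rfl fun s _ => Finset.sum_congr rfl fun i _ => by ring
  rw [h7] at h1
  set F := ∑ s ∈ Finset.range T, ∑ i ∈ Finset.range T, increase D σ s i * (σ i).cost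
  set L := Real.log N.mc
  have h8 : 12 * L * F ≤ 12 * L * (2 * (2 * D * L) * guess D σ T) := by gcongr
  have h9 := guess_le_two_mul_optCost hN hD σ T
  have h10 : 0 ≤ optCost σ T := optCost_nonneg σ T
  have hL23 : 2 / 3 ≤ L := by linarith [N.log_two_le hN, Real.log_two_gt_d9]
  -- Here 1 comes from small requests, `96 = 2 * 12 * 4` from heavy requests and coins together, and
  -- `4 * (D * L + 2)` from the capacity checks.
  have h11 : (1 + 96 * D * L ^ 2 + 4 * (D * L + 2)) * guess D σ T ≤
      (1 + 96 * D * L ^ 2 + 4 * (D * L + 2)) * (2 * optCost σ T) := by gcongr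
  -- As `L ≥ 2/3`, lower powers of `L` are absorbed into `L ^ 2`: `192 + 8 * 3/2 = 204` and `19 * 3
  -- = 57`.
  have h12 : 1 + 2 * (1 + 96 * D * L ^ 2 + 4 * (D * L + 2)) ≤ (204 * D + 57) * L ^ 2 := by
    have e1 : L ≤ 3 / 2 * L ^ 2 := by nlinarith
    have e2 : 1 ≤ 3 * L ^ 2 := by nlinarith
    have e3 : D * L ≤ D * (3 / 2 * L ^ 2) := by gcongr
    nlinarith
  have h13 := mul_le_mul_of_nonneg_right h12 h10
  calc _ ≤ optCost σ T + (1 + 96 * D * L ^ 2 + 4 * (D * L + 2)) * guess D σ T := by linarith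
    _ ≤ (1 + 2 * (1 + 96 * D * L ^ 2 + 4 * (D * L + 2))) * optCost σ T := by linarith
    _ ≤ _ := h13

end AdmissionControl

theorem theorem3p1 :
    ∃ D₀ : ℝ, 0 < D₀ ∧ ∀ D : ℝ, D₀ ≤ D → ∃ K : ℝ, 0 < K ∧
      ∀ {V E : Type*} [Fintype E] [DecidableEq E] (N : AdmissionControl.Network V E),
        2 ≤ N.m * N.c →
          AdmissionControl.IsPreemptiveOnline (AdmissionControl.randomizedAlgorithm N D) ∧
          AdmissionControl.IsCompetitive AdmissionControl.coinMeasure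
            (K * Real.log ((N.m : ℝ) * (N.c : ℝ)) ^ 2)
            (AdmissionControl.randomizedAlgorithm N D) := by
  refine ⟨24, by norm_num, fun D hD => ⟨204 * D + 57, by linarith, fun N hN => ⟨?_, ?_⟩⟩⟩
  · exact AdmissionControl.isPreemptiveOnline_randomizedAlgorithm hN hD
  · exact fun σ t => ⟨AdmissionControl.integrable_rejectionCost D σ t,
      AdmissionControl.integral_rejectionCost_le_optCost hN hD σ t⟩
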